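/- Let $n, d \ge 0$ be integers. A mold of degree $n$ and rank $d$ on a scheme $X$ is a subsheaf of $\mathcal{O}_X$-algebras $\mathcal{A} \subseteq \mathrm{M}_n(\mathcal{O}_X)$ such that $\mathcal{A}$ is locally free of rank $d$ and $\mathrm{M}_n(\mathcal{O}_X)/\mathcal{A}$ is locally free. The contravariant functor sending a scheme $X$ to the set of molds of degree $n$ and rank $d$ on $X$, and a morphism to the pullback of molds, is representable by a scheme $\mathrm{Mold}_{n,d}$. Let $\mathcal{A}$ be the universal mold on $\mathrm{Mold}_{n,d}$, let $x \in \mathrm{Mold}_{n,d}$ be a point with residue field $k(x)$, and put $\mathcal{A}(x) = \mathcal{A} \otimes_{\mathcal{O}_{\mathrm{Mold}_{n,d}}} k(x) \subseteq \mathrm{M}_n(k(x))$. If the second Hochschild cohomology over $k(x)$ of the algebra $\mathcal{A}(x)$ with coefficients in the $\mathcal{A}(x)$-bimodule $\mathrm{M}_n(k(x))/\mathcal{A}(x)$ vanishes, $$H^2\bigl(\mathcal{A}(x), \mathrm{M}_n(k(x))/\mathcal{A}(x)\bigr) = 0,$$ then the canonical morphism $\mathrm{Mold}_{n,d} \to \operatorname{Spec}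 \mathbb{Z}$ is smooth at $x$, that is, smooth on an open neighbourhood of $x$. Here $H^p(A, M)$ is the cohomology of the Hochschild complex $C^p(A, M) = \mathrm{Hom}_k(A^{\otimes p}, M)$ with $$(d^p f)(a_1 \otimes \cdots \otimes a_{p+1}) = a_1 f(a_2 \otimes \cdots \otimes a_{p+1}) + \sum_{i=1}^{p} (-1)^i f(a_1 \otimes \cdots \otimes a_i a_{i+1} \otimes \cdots \otimes a_{p+1}) + (-1)^{p+1} f(a_1 \otimes \cdots \otimes a_p)\, a_{p+1}.$$ -/

import Mathlib

open CategoryTheory AlgebraicGeometry Opposite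

universe u

/-! ### Hochschild cohomology of an associative algebra with coefficients in a bimodule -/

section Hochschild

variable (R : Type*) [CommRing R] (A : Type*) [Ring A] [Algebra R A]
  (M : Type*) [AddCommGroup M] [Module R M] [Module A M] [Module Aᵐᵒᵖ M]
  [IsScalarTower R A M] [IsScalarTower R Aᵐᵒᵖ M]

/-- The module `C^p(A, M) = Hom_R(A ⊗ ⋯ ⊗ A, M)` of Hochschild `p`-cochains, as the module of
`R`-multilinear maps `A^p → M`. Left multiplication by `a` on the bimodule `M` is `a • m`, right
multiplication is `MulOpposite.op a • m`. -/
abbrev HochschildCochain (p : ℕ) : Type _ := MultilinearMap R (fun _ : Fin p => A) M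

namespace HochschildCochain

variable {R A M}

/-- The term `a₁ · f(a₂, …, a_{p+1})`. -/
def leftTerm {p : ℕ} (f : HochschildCochain R A M p) : HochschildCochain R A M (p + 1) where
  toFun a := a 0 • f (Fin.tail a)
  map_update_add' {dec} a i x y := by
    obtain rfl := Subsingleton.elim dec (instDecidableEqFin _)
    refine Fin.cases ?_ (fun i => ?_) i
    · simp [add_smul]
    · simp [Function.update_of_ne (Fin.succ_ne_zero i).symm]
  map_update_smul' {dec} a i c x := by
    obtain rfl := Subsingleton.elim dec (instDecidableEqFin _)
    refine Fin.cases ?_ (fun i => ?_) i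
    · simp
    · simp only [Fin.tail_update_succ, MultilinearMap.map_update_smul,
        Function.update_of_ne (Fin.succ_ne_zero i).symm]
      rw [← algebraMap_smul A c, ← algebraMap_smul A c, smul_smul, smul_smul, Algebra.commutes]

/-- The term `f(a₁, …, a_p) · a_{p+1}`. -/
def rightTerm {p : ℕ} (f : HochschildCochain R A M p) : HochschildCochain R A M (p + 1) where
  toFun a := MulOpposite.op (a (Fin.last p)) • f (Fin.init a)
  map_update_add' {dec} a i x y := by
    obtain rfl := Subsingleton.elim dec (instDecidableEqFin _)
    refine Fin.lastCases ?_ (fun i => ?_) i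
    · simp [add_smul]
    · simp [Function.update_of_ne (Fin.castSucc_lt_last i).ne']
  map_update_smul' {dec} a i c x := by
    obtain rfl := Subsingleton.elim dec (instDecidableEqFin _)
    refine Fin.lastCases ?_ (fun i => ?_) i
    · simp
    · simp only [Fin.init_update_castSucc, MultilinearMap.map_update_smul,
        Function.update_of_ne (Fin.castSucc_lt_last i).ne']
      rw [← algebraMap_smul Aᵐᵒᵖ c, ← algebraMap_smul Aᵐᵒᵖ c, smul_smul, smul_smul,
        Algebra.commutes]

theorem contractNth_update {p : ℕ} (j : Fin p) (a : Fin (p + 1) → A) (i : Fin (p + 1)) :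
    ∃ (k : Fin p) (l : A →ₗ[R] A), ∀ x, Fin.contractNth j.castSucc (· * ·) (Function.update a i x) =
      Function.update (Fin.contractNth j.castSucc (· * ·) a) k (l x) := by
  rcases lt_trichotomy i j.castSucc with h | h | h
  · have hi : (i : ℕ) < j := h
    refine ⟨⟨i, by omega⟩, LinearMap.id, fun x => ?_⟩
    funext k
    simp only [Fin.contractNth, Function.update_apply, Fin.ext_iff, Fin.val_castSucc, Fin.val_succ,
      LinearMap.id_apply]
    grind
  · subst h
    refine ⟨j, LinearMap.mulRight R (a j.succ), fun x => ?_⟩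
    funext k
    simp only [Fin.contractNth, Function.update_apply, Fin.ext_iff, Fin.val_castSucc, Fin.val_succ,
      LinearMap.mulRight_apply]
    grind
  · have hi : (j : ℕ) < i := h
    rcases eq_or_ne i j.succ with rfl | h'
    · refine ⟨j, LinearMap.mulLeft R (a j.castSucc), fun x => ?_⟩
      funext k
      simp only [Fin.contractNth, Function.update_apply, Fin.ext_iff, Fin.val_castSucc,
        Fin.val_succ, LinearMap.mulLeft_apply]
      grind
    · have hi' : (i : ℕ) ≠ j + 1 := fun h => h' (Fin.ext (by simpa using h))
      refine ⟨⟨i - 1, by omega⟩, LinearMap.id, fun x => ?_⟩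
      funext k
      simp only [Fin.contractNth, Function.update_apply, Fin.ext_iff, Fin.val_castSucc,
        Fin.val_succ, LinearMap.id_apply]
      grind

/-- With `j = i - 1`, the term `f(a₁, …, a_i a_{i+1}, …, a_{p+1})` for `1 ≤ i ≤ p`. -/
def middleTerm {p : ℕ} (j : Fin p) (f : HochschildCochain R A M p) :
    HochschildCochain R A M (p + 1) where
  toFun a := f (Fin.contractNth j.castSucc (· * ·) a)
  map_update_add' {dec} a i x y := by
    obtain rfl := Subsingleton.elim dec (instDecidableEqFin _)
    obtain ⟨k, l, h⟩ := contractNth_update (R := R) j a i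
    simp [h]
  map_update_smul' {dec} a i c x := by
    obtain rfl := Subsingleton.elim dec (instDecidableEqFin _)
    obtain ⟨k, l, h⟩ := contractNth_update (R := R) j a i
    simp [h]

variable (R A M) in
/-- The Hochschild coboundary `d^p : C^p(A, M) → C^{p+1}(A, M)`,
`(d^p f)(a₁, …, a_{p+1}) = a₁ f(a₂, …, a_{p+1}) + ∑ᵢ (-1)^i f(a₁, …, aᵢ aᵢ₊₁, …, a_{p+1})
  + (-1)^(p+1) f(a₁, …, a_p) a_{p+1}`. -/
def d (p : ℕ) :
    HochschildCochain R A M p →ₗ[R] HochschildCochain R A M (p + 1) where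
  toFun f := leftTerm f + ∑ j : Fin p, (-1 : R) ^ ((j : ℕ) + 1) • middleTerm j f
    + (-1 : R) ^ (p + 1) • rightTerm f
  map_add' f g := by
    ext a
    simp [leftTerm, rightTerm, middleTerm, Finset.sum_add_distrib]
    abel
  map_smul' c f := by
    ext a
    simp [leftTerm, rightTerm, middleTerm, Finset.smul_sum, smul_comm c]

variable (R A M) in
/-- The submodule of Hochschild `p`-coboundaries in `C^p(A, M)`. -/
def coboundaries :
    (p : ℕ) → Submodule R (HochschildCochain R A M p)
  | 0 => ⊥
  | p + 1 => LinearMap.range (d R A M p)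

variable (R A M) in
/-- The submodule of Hochschild `p`-cocycles in `C^p(A, M)`. -/
def cocycles (p : ℕ) :
    Submodule R (HochschildCochain R A M p) :=
  LinearMap.ker (d R A M p)

end HochschildCochain

/-- The Hochschild cohomology `H^p(A, M)`: cocycles modulo coboundaries. -/
abbrev HochschildCohomology [SMulCommClass A Aᵐᵒᵖ M] (p : ℕ) : Type _ :=
  HochschildCochain.cocycles R A M p ⧸
    (HochschildCochain.coboundaries R A M p).comap (HochschildCochain.cocycles R A M p).subtype

end Hochschild

/-! ### The bimodule `B / A` for a subalgebra `A ⊆ B` -/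

section Quotient

variable {R : Type*} [CommRing R] {B : Type*} [Ring B] [Algebra R B] (A : Subalgebra R B)

namespace Subalgebra

/-- `a • [b] = [a b]`. -/
instance quotientLeftModule : Module A (B ⧸ toSubmodule A) where
  smul a := (toSubmodule A).mapQ (toSubmodule A) (LinearMap.mulLeft R (a : B))
    fun b hb => A.mul_mem a.2 hb
  one_smul m := by
    obtain ⟨b, rfl⟩ := Submodule.Quotient.mk_surjective _ m
    exact congrArg Submodule.Quotient.mk (one_mul b)
  mul_smul x y m := by
    obtain ⟨b, rfl⟩ := Submodule.Quotient.mk_surjective _ m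
    exact congrArg Submodule.Quotient.mk (mul_assoc (x : B) y b)
  smul_zero x := map_zero _
  smul_add x m m' := map_add _ m m'
  add_smul x y m := by
    obtain ⟨b, rfl⟩ := Submodule.Quotient.mk_surjective _ m
    exact congrArg Submodule.Quotient.mk (add_mul (x : B) y b)
  zero_smul m := by
    obtain ⟨b, rfl⟩ := Submodule.Quotient.mk_surjective _ m
    exact congrArg Submodule.Quotient.mk (zero_mul b)

/-- `op a • [b] = [b a]`. -/
instance quotientRightModule : Module Aᵐᵒᵖ (B ⧸ toSubmodule A) where
  smul a := (toSubmodule A).mapQ (toSubmodule A) (LinearMap.mulRight R (a.unop : B))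
    fun b hb => A.mul_mem hb a.unop.2
  one_smul m := by
    obtain ⟨b, rfl⟩ := Submodule.Quotient.mk_surjective _ m
    exact congrArg Submodule.Quotient.mk (mul_one b)
  mul_smul x y m := by
    obtain ⟨b, rfl⟩ := Submodule.Quotient.mk_surjective _ m
    exact congrArg Submodule.Quotient.mk (mul_assoc b (y.unop : B) x.unop).symm
  smul_zero x := map_zero _
  smul_add x m m' := map_add _ m m'
  add_smul x y m := by
    obtain ⟨b, rfl⟩ := Submodule.Quotient.mk_surjective _ m
    exact congrArg Submodule.Quotient.mk (mul_add b (x.unop : B) y.unop)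
  zero_smul m := by
    obtain ⟨b, rfl⟩ := Submodule.Quotient.mk_surjective _ m
    exact congrArg Submodule.Quotient.mk (mul_zero b)

theorem quotient_smul_mk (a : A) (b : B) :
    a • (Submodule.Quotient.mk b : B ⧸ toSubmodule A) = Submodule.Quotient.mk ((a : B) * b) := rfl

theorem quotient_op_smul_mk (a : A) (b : B) :
    MulOpposite.op a • (Submodule.Quotient.mk b : B ⧸ toSubmodule A) =
      Submodule.Quotient.mk (b * (a : B)) := rfl

instance quotient_isScalarTower : IsScalarTower R A (B ⧸ toSubmodule A) where
  smul_assoc r a m := by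
    obtain ⟨b, rfl⟩ := Submodule.Quotient.mk_surjective _ m
    exact congrArg Submodule.Quotient.mk (smul_mul_assoc r (a : B) b)

instance quotient_isScalarTower_op : IsScalarTower R Aᵐᵒᵖ (B ⧸ toSubmodule A) where
  smul_assoc r a m := by
    obtain ⟨b, rfl⟩ := Submodule.Quotient.mk_surjective _ m
    exact congrArg Submodule.Quotient.mk (mul_smul_comm r b (a.unop : B))

instance quotient_bimodule : SMulCommClass A Aᵐᵒᵖ (B ⧸ toSubmodule A) where
  smul_comm a a' m := by
    obtain ⟨b, rfl⟩ := Submodule.Quotient.mk_surjective _ m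
    exact congrArg Submodule.Quotient.mk (mul_assoc (a : B) b a'.unop).symm

end Subalgebra

end Quotient

/-! ### Molds on schemes -/

noncomputable section

/-- The subalgebra of `M_n(S)` generated over `S` by the image of `s ⊆ M_n(R)` under a ring
homomorphism `φ : R → S`; if `s` is a subalgebra, this is the image of `S ⊗_R s → M_n(S)`. -/
def matrixExtend {R S : Type*} [CommRing R] [CommRing S] {n : ℕ} (φ : R →+* S)
    (s : Set (Matrix (Fin n) (Fin n) R)) : Subalgebra S (Matrix (Fin n) (Fin n) S) :=
  Algebra.adjoin S (φ.mapMatrix '' s)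

section MatrixExtend

variable {R S T : Type*} [CommRing R] [CommRing S] [CommRing T] {n : ℕ}

theorem mapMatrix_mem_matrixExtend (φ : R →+* S) {s : Set (Matrix (Fin n) (Fin n) R)}
    {a : Matrix (Fin n) (Fin n) R} (h : a ∈ s) : φ.mapMatrix a ∈ matrixExtend φ s :=
  Algebra.subset_adjoin ⟨a, h, rfl⟩

theorem matrixExtend_le (φ : R →+* S) {s : Set (Matrix (Fin n) (Fin n) R)}
    {A : Subalgebra S (Matrix (Fin n) (Fin n) S)} (h : ∀ a ∈ s, φ.mapMatrix a ∈ A) :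
    matrixExtend φ s ≤ A :=
  Algebra.adjoin_le (by rintro _ ⟨a, ha, rfl⟩; exact h a ha)

theorem mapMatrix_mem_of_mem_matrixExtend (φ : R →+* S) (ψ : S →+* T)
    {s : Set (Matrix (Fin n) (Fin n) R)} {A : Subalgebra T (Matrix (Fin n) (Fin n) T)}
    (h : ∀ a ∈ s, (ψ.comp φ).mapMatrix a ∈ A) {m : Matrix (Fin n) (Fin n) S}
    (hm : m ∈ matrixExtend φ s) : ψ.mapMatrix m ∈ A := by
  induction hm using Algebra.adjoin_induction with
  | mem x hx =>
    obtain ⟨a, ha, rfl⟩ := hx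
    exact h a ha
  | algebraMap r =>
    have : ψ.mapMatrix (algebraMap S (Matrix (Fin n) (Fin n) S) r) =
        algebraMap T (Matrix (Fin n) (Fin n) T) (ψ r) := by
      ext i j
      simp [Matrix.algebraMap_matrix_apply, apply_ite ψ]
    rw [this]
    exact A.algebraMap_mem _
  | add x y _ _ hx hy => rw [map_add]; exact A.add_mem hx hy
  | mul x y _ _ hx hy => rw [map_mul]; exact A.mul_mem hx hy

theorem mapMatrix_smul' (φ : R →+* S) (r : R) (m : Matrix (Fin n) (Fin n) R) :
    φ.mapMatrix (r • m) = φ r • φ.mapMatrix m := by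
  ext i j; simp

theorem mapMatrix_mem_span (φ : R →+* S) {ι : Type*} (b : ι → Matrix (Fin n) (Fin n) R)
    {a : Matrix (Fin n) (Fin n) R} (h : a ∈ Submodule.span R (Set.range b)) :
    φ.mapMatrix a ∈ Submodule.span S (Set.range fun i => φ.mapMatrix (b i)) := by
  induction h using Submodule.span_induction with
  | mem x hx => obtain ⟨i, rfl⟩ := hx; exact Submodule.subset_span ⟨i, rfl⟩
  | zero => rw [map_zero]; exact zero_mem _
  | add x y _ _ hx hy => rw [map_add]; exact add_mem hx hy
  | smul r x _ hx => rw [mapMatrix_smul']; exact Submodule.smul_mem _ _ hx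

theorem matrixExtend_toSubmodule (φ : R →+* S) (A : Subalgebra R (Matrix (Fin n) (Fin n) R))
    {ι : Type*} (b : ι → Matrix (Fin n) (Fin n) R)
    (hb : Submodule.span R (Set.range b) = Subalgebra.toSubmodule A) :
    Subalgebra.toSubmodule (matrixExtend φ (A : Set (Matrix (Fin n) (Fin n) R))) =
      Submodule.span S (Set.range fun i => φ.mapMatrix (b i)) := by
  apply le_antisymm
  · have hc : (Submonoid.closure (φ.mapMatrix '' (A : Set (Matrix (Fin n) (Fin n) R))) :
        Set (Matrix (Fin n) (Fin n) S)) = φ.mapMatrix '' (A : Set (Matrix (Fin n) (Fin n) R)) := by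
      have := Submonoid.closure_eq
        (A.toSubmonoid.map (φ.mapMatrix (m := Fin n)).toMonoidHom)
      exact congrArg SetLike.coe this
    rw [matrixExtend, Algebra.adjoin_eq_span, hc, Submodule.span_le]
    rintro _ ⟨a, ha, rfl⟩
    exact mapMatrix_mem_span φ b (hb ▸ ha)
  · rw [Submodule.span_le]
    rintro _ ⟨i, rfl⟩
    have : b i ∈ Subalgebra.toSubmodule A := hb ▸ Submodule.subset_span ⟨i, rfl⟩
    exact mapMatrix_mem_matrixExtend φ this

theorem repr_mapMatrix (φ : R →+* S) {ι : Type*} [Finite ι]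
    (t : Module.Basis ι R (Matrix (Fin n) (Fin n) R)) (t' : Module.Basis ι S (Matrix (Fin n) (Fin n) S))
    (h : ∀ k, t' k = φ.mapMatrix (t k)) (m : Matrix (Fin n) (Fin n) R) (k : ι) :
    t'.repr (φ.mapMatrix m) k = φ (t.repr m k) := by
  classical
  have := Fintype.ofFinite ι
  conv_lhs => rw [← t.sum_repr m]
  simp only [map_sum, mapMatrix_smul', ← h, map_smul, Module.Basis.repr_self, Finsupp.coe_finsetSum,
    Finset.sum_apply, Finsupp.smul_apply, smul_eq_mul, Finsupp.single_apply]
  simp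

/-- The image of an `R`-basis of `M_n(R)` is an `S`-basis of `M_n(S)`. -/
theorem exists_basis_mapMatrix (φ : R →+* S) {ι : Type*} [Finite ι]
    (t : Module.Basis ι R (Matrix (Fin n) (Fin n) R)) :
    ∃ t' : Module.Basis ι S (Matrix (Fin n) (Fin n) S), ∀ k, t' k = φ.mapMatrix (t k) := by
  classical
  have := Fintype.ofFinite ι
  have hli : LinearIndependent S (fun k => φ.mapMatrix (t k)) := by
    rw [Fintype.linearIndependent_iff]
    intro g hg l
    have key : ∀ k, ∑ i, ∑ j, t k i j * t.repr (Matrix.single i j 1) l = if k = l then 1 else 0 := by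
      intro k
      have h1 : t k = ∑ i, ∑ j, t k i j • Matrix.single i j (1 : R) := by
        conv_lhs => rw [Matrix.matrix_eq_sum_single (t k)]
        simp [Matrix.smul_single]
      have h2 := congrArg (fun m => t.repr m l) h1
      simp only [Module.Basis.repr_self, map_sum, map_smul, Finsupp.coe_finsetSum,
        Finset.sum_apply, Finsupp.smul_apply, smul_eq_mul, Finsupp.single_apply] at h2
      exact h2.symm
    have hz : ∀ i j, ∑ k, g k * φ (t k i j) = 0 := by
      intro i j
      have := congrFun (congrFun hg i) j
      simpa [Matrix.sum_apply] using this
    have hsum : ∑ i, ∑ j, (∑ k, g k * φ (t k i j)) * φ (t.repr (Matrix.single i j 1) l) = g l := by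
      calc _ = ∑ k, g k * φ (∑ i, ∑ j, t k i j * t.repr (Matrix.single i j 1) l) := by
            simp only [Finset.sum_mul, map_sum, map_mul, Finset.mul_sum]
            rw [Finset.sum_congr rfl fun i _ => Finset.sum_comm, Finset.sum_comm]
            simp only [mul_assoc]
        _ = g l := by simp [key]
    rw [← hsum]
    simp [hz]
  have hsp : ⊤ ≤ Submodule.span S (Set.range fun k => φ.mapMatrix (t k)) := by
    intro m _
    rw [Matrix.matrix_eq_sum_single m]
    refine Submodule.sum_mem _ fun i _ => Submodule.sum_mem _ fun j _ => ?_
    have h1 : Matrix.single i j (m i j) = m i j • φ.mapMatrix (Matrix.single i j (1 : R)) := by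
      ext a b
      simp [Matrix.single_apply]
    rw [h1]
    refine Submodule.smul_mem _ _ (mapMatrix_mem_span φ t ?_)
    rw [t.span_eq]
    trivial
  exact ⟨Module.Basis.mk hli hsp, fun k => by simp⟩

end MatrixExtend

namespace AlgebraicGeometry

/-- Restriction `M_n(Γ(X, U)) → M_n(Γ(X, V))` of matrices of functions for `V ≤ U`. -/
def matrixRes (X : Scheme.{u}) (n : ℕ) {U V : X.Opens} (h : V ≤ U) :
    Matrix (Fin n) (Fin n) Γ(X, U) →+* Matrix (Fin n) (Fin n) Γ(X, V) :=
  (X.presheaf.map (homOfLE h).op).hom.mapMatrix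

theorem matrixRes_matrixRes {X : Scheme.{u}} {n : ℕ} {U V W : X.Opens} (h : V ≤ U) (h' : W ≤ V)
    (a : Matrix (Fin n) (Fin n) Γ(X, U)) :
    matrixRes X n h' (matrixRes X n h a) = matrixRes X n (h'.trans h) a := by
  ext i j
  simp only [matrixRes, RingHom.mapMatrix_apply, Matrix.map_apply]
  rw [← CommRingCat.comp_apply, ← Functor.map_comp]
  rfl

theorem eq_zero_of_locally_eq_zero {Y : Scheme.{u}} {V : Y.Opens} (s : Γ(Y, V))
    (h : ∀ y ∈ V, ∃ (W : Y.Opens) (hW : W ≤ V), y ∈ W ∧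
      (Y.presheaf.map (homOfLE hW).op).hom s = 0) : s = 0 := by
  refine TopCat.Presheaf.section_ext Y.sheaf V s 0 fun y hy => ?_
  obtain ⟨W, hW, hyW, hs⟩ := h y hy
  have h1 := Y.presheaf.germ_res_apply (homOfLE hW) y hyW s
  have h2 : Y.presheaf.germ W y hyW (Y.presheaf.map (homOfLE hW).op s) = 0 := by
    rw [show Y.presheaf.map (homOfLE hW).op s = 0 from hs, map_zero]
  rw [h2] at h1
  exact h1.symm.trans (map_zero _).symm

theorem matrixRes_appLE {X Y : Scheme.{u}} {n : ℕ} (f : Y ⟶ X) {U : X.Opens} {V W : Y.Opens}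
    (hV : V ≤ f ⁻¹ᵁ U) (h : W ≤ V) (a : Matrix (Fin n) (Fin n) Γ(X, U)) :
    matrixRes Y n h ((f.appLE U V hV).hom.mapMatrix a) =
      (f.appLE U W (h.trans hV)).hom.mapMatrix a := by
  ext i j
  simp only [matrixRes, RingHom.mapMatrix_apply, Matrix.map_apply]
  rw [← CommRingCat.comp_apply, Scheme.Hom.appLE_map]

theorem appLE_matrixRes {X Y : Scheme.{u}} {n : ℕ} (f : Y ⟶ X) {U U' : X.Opens} {V : Y.Opens}
    (hV : V ≤ f ⁻¹ᵁ U') (h : U' ≤ U) (a : Matrix (Fin n) (Fin n) Γ(X, U)) :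
    (f.appLE U' V hV).hom.mapMatrix (matrixRes X n h a) =
      (f.appLE U V (hV.trans (f.preimage_mono h))).hom.mapMatrix a := by
  ext i j
  simp only [matrixRes, RingHom.mapMatrix_apply, Matrix.map_apply]
  rw [← CommRingCat.comp_apply, Scheme.Hom.map_appLE]

theorem appLE_appLE_mapMatrix {X Y Z : Scheme.{u}} {n : ℕ} (g : Z ⟶ Y) (f : Y ⟶ X) {U : X.Opens}
    {V : Y.Opens} {W : Z.Opens} (hV : V ≤ f ⁻¹ᵁ U) (hW : W ≤ g ⁻¹ᵁ V)
    (a : Matrix (Fin n) (Fin n) Γ(X, U)) :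
    (g.appLE V W hW).hom.mapMatrix ((f.appLE U V hV).hom.mapMatrix a) =
      ((g ≫ f).appLE U W (hW.trans (g.preimage_mono hV))).hom.mapMatrix a := by
  ext i j
  simp only [RingHom.mapMatrix_apply, Matrix.map_apply]
  rw [← CommRingCat.comp_apply, Scheme.Hom.appLE_comp_appLE]

/-- A mold of degree `n` and rank `d` on a scheme `X`: a subsheaf `𝒜` of `𝒪_X`-algebras of
`M_n(𝒪_X)` such that `𝒜` is locally free of rank `d` and `M_n(𝒪_X)/𝒜` is locally free.

Local freeness is expressed by local bases, which are required to stay bases on all smaller opens.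
In `quotient_locally_free` the presheaf quotient `V ↦ M_n(Γ(X, V))/𝒜(V)` is used; wherever the
quotient sheaf is free, one can lift a basis locally to `M_n(𝒪_X)`, and then `M_n(𝒪_X)` is the direct
sum of `𝒜` and the span of the lifts, so the two quotients agree on the opens in question. -/
@[ext]
structure Mold (n d : ℕ) (X : Scheme.{u}) where
  /-- The algebra of sections of the mold over an open subset. -/
  sections (U : X.Opens) : Subalgebra Γ(X, U) (Matrix (Fin n) (Fin n) Γ(X, U))
  res_mem {U V : X.Opens} (h : V ≤ U) {a : Matrix (Fin n) (Fin n) Γ(X, U)} (ha : a ∈ sections U) :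
    matrixRes X n h a ∈ sections V
  mem_of_locally_mem {U : X.Opens} (a : Matrix (Fin n) (Fin n) Γ(X, U))
    (ha : ∀ x ∈ U, ∃ (V : X.Opens) (h : V ≤ U), x ∈ V ∧ matrixRes X n h a ∈ sections V) :
    a ∈ sections U
  locally_free (x : X) : ∃ U : X.Opens, x ∈ U ∧
    ∃ b : Fin d → Matrix (Fin n) (Fin n) Γ(X, U), ∀ (V : X.Opens) (h : V ≤ U),
      LinearIndependent Γ(X, V) (fun i => matrixRes X n h (b i)) ∧
      Submodule.span Γ(X, V) (Set.range fun i => matrixRes X n h (b i)) =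
        Subalgebra.toSubmodule (sections V)
  quotient_locally_free (x : X) : ∃ U : X.Opens, x ∈ U ∧
    ∃ (e : ℕ) (c : Fin e → Matrix (Fin n) (Fin n) Γ(X, U)), ∀ (V : X.Opens) (h : V ≤ U),
      LinearIndependent Γ(X, V)
        (fun j => (Subalgebra.toSubmodule (sections V)).mkQ (matrixRes X n h (c j))) ∧
      Submodule.span Γ(X, V) (Set.range fun j =>
        (Subalgebra.toSubmodule (sections V)).mkQ (matrixRes X n h (c j))) = ⊤

namespace Mold

variable {n d : ℕ} {X Y Z : Scheme.{u}}

theorem exists_basis (A : Mold n d X) (x : X) : ∃ U : X.Opens, x ∈ U ∧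
    ∃ (e : ℕ) (t : Module.Basis (Fin d ⊕ Fin e) Γ(X, U) (Matrix (Fin n) (Fin n) Γ(X, U))),
      ∀ (V : X.Opens) (h : V ≤ U),
        Submodule.span Γ(X, V) (Set.range fun i => matrixRes X n h (t (Sum.inl i))) =
          Subalgebra.toSubmodule (A.sections V) := by
  obtain ⟨U, hxU, b, hb⟩ := A.locally_free x
  obtain ⟨U', hxU', e, c, hc⟩ := A.quotient_locally_free x
  have hW : U ⊓ U' ≤ U := inf_le_left
  have hW' : U ⊓ U' ≤ U' := inf_le_right
  let N := Subalgebra.toSubmodule (A.sections (U ⊓ U'))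
  let bW : Module.Basis (Fin d) Γ(X, U ⊓ U') N :=
    (Module.Basis.span (hb _ hW).1).map (LinearEquiv.ofEq _ _ (hb _ hW).2)
  have hbW : ∀ i, (bW i : Matrix (Fin n) (Fin n) Γ(X, U ⊓ U')) = matrixRes X n hW (b i) := by
    intro i
    simp [bW, Module.Basis.span_apply]
  let bQ : Module.Basis (Fin e) Γ(X, U ⊓ U') (Matrix (Fin n) (Fin n) Γ(X, U ⊓ U') ⧸ N) :=
    Module.Basis.mk (hc _ hW').1 (hc _ hW').2.ge
  refine ⟨U ⊓ U', ⟨hxU, hxU'⟩, e, Module.Basis.sumQuot bW bQ, fun V h => ?_⟩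
  rw [← (hb V (h.trans hW)).2]
  congr 2
  funext i
  rw [Module.Basis.sumQuot_inl, hbW]
  exact matrixRes_matrixRes _ _ _

/-- Membership in the image of `f^* A → M_n(𝒪_Y)` for a morphism `f : Y ⟶ X`: the matrix lies
locally in the subalgebra generated by pullbacks of sections of `A`. -/
def MemPullback (A : Mold n d X) (f : Y ⟶ X) {V : Y.Opens}
    (m : Matrix (Fin n) (Fin n) Γ(Y, V)) : Prop :=
  ∀ y ∈ V, ∃ (U : X.Opens) (W : Y.Opens) (hWV : W ≤ V) (hWU : W ≤ f ⁻¹ᵁ U),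
    y ∈ W ∧ matrixRes Y n hWV m ∈ matrixExtend (f.appLE U W hWU).hom (A.sections U)

theorem matrixExtend_mono (A : Mold n d X) (f : Y ⟶ X) {U U' : X.Opens} {W W' : Y.Opens}
    (hU : U' ≤ U) (hW : W' ≤ W) (h : W ≤ f ⁻¹ᵁ U) (h' : W' ≤ f ⁻¹ᵁ U')
    {m : Matrix (Fin n) (Fin n) Γ(Y, W)} (hm : m ∈ matrixExtend (f.appLE U W h).hom (A.sections U)) :
    matrixRes Y n hW m ∈ matrixExtend (f.appLE U' W' h').hom (A.sections U') := by
  refine mapMatrix_mem_of_mem_matrixExtend _ _ (fun a ha => ?_) hm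
  have h1 := matrixRes_appLE f h hW a
  rw [← appLE_matrixRes f h' hU a] at h1
  have h2 := mapMatrix_mem_matrixExtend (f.appLE U' W' h').hom (A.res_mem hU ha)
  rw [← h1] at h2
  exact h2

theorem MemPullback.exists_common {A : Mold n d X} {f : Y ⟶ X} {V : Y.Opens}
    {m m' : Matrix (Fin n) (Fin n) Γ(Y, V)} (hm : A.MemPullback f m) (hm' : A.MemPullback f m')
    {y : Y} (hy : y ∈ V) :
    ∃ (U : X.Opens) (W : Y.Opens) (hWV : W ≤ V) (hWU : W ≤ f ⁻¹ᵁ U), y ∈ W ∧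
      matrixRes Y n hWV m ∈ matrixExtend (f.appLE U W hWU).hom (A.sections U) ∧
      matrixRes Y n hWV m' ∈ matrixExtend (f.appLE U W hWU).hom (A.sections U) := by
  obtain ⟨U, W, hWV, hWU, hyW, h⟩ := hm y hy
  obtain ⟨U', W', hWV', hWU', hyW', h'⟩ := hm' y hy
  have hle : W ⊓ W' ≤ f ⁻¹ᵁ (U ⊓ U') := fun z hz => ⟨hWU hz.1, hWU' hz.2⟩
  refine ⟨U ⊓ U', W ⊓ W', inf_le_left.trans hWV, hle, ⟨hyW, hyW'⟩, ?_, ?_⟩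
  · have := A.matrixExtend_mono f (inf_le_left : U ⊓ U' ≤ U) (inf_le_left : W ⊓ W' ≤ W) hWU hle h
    rwa [matrixRes_matrixRes] at this
  · have := A.matrixExtend_mono f (inf_le_right : U ⊓ U' ≤ U') (inf_le_right : W ⊓ W' ≤ W')
      hWU' hle h'
    rwa [matrixRes_matrixRes] at this

/-- The sections over `V` of the pullback of `A` along `f`, i.e. of the image of
`f^* A → M_n(𝒪_Y)`. -/
def pullbackSections (A : Mold n d X) (f : Y ⟶ X) (V : Y.Opens) :
    Subalgebra Γ(Y, V) (Matrix (Fin n) (Fin n) Γ(Y, V)) where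
  carrier := {m | A.MemPullback f m}
  mul_mem' hm hm' y hy := by
    obtain ⟨U, W, hWV, hWU, hyW, h, h'⟩ := MemPullback.exists_common hm hm' hy
    exact ⟨U, W, hWV, hWU, hyW, by rw [map_mul]; exact mul_mem h h'⟩
  add_mem' hm hm' y hy := by
    obtain ⟨U, W, hWV, hWU, hyW, h, h'⟩ := MemPullback.exists_common hm hm' hy
    exact ⟨U, W, hWV, hWU, hyW, by rw [map_add]; exact add_mem h h'⟩
  algebraMap_mem' r y hy := by
    refine ⟨⊤, V, le_rfl, le_top, hy, ?_⟩
    rw [Algebra.algebraMap_eq_smul_one, matrixRes, mapMatrix_smul', map_one]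
    exact Subalgebra.smul_mem _ (one_mem _) _

theorem pullbackSections_res_mem (A : Mold n d X) (f : Y ⟶ X) {V V' : Y.Opens} (h : V' ≤ V)
    {m : Matrix (Fin n) (Fin n) Γ(Y, V)} (hm : m ∈ A.pullbackSections f V) :
    matrixRes Y n h m ∈ A.pullbackSections f V' := by
  intro y hy
  obtain ⟨U, W, hWV, hWU, hyW, hm⟩ := hm y (h hy)
  have hle : W ⊓ V' ≤ f ⁻¹ᵁ U := inf_le_left.trans hWU
  refine ⟨U, W ⊓ V', inf_le_right, hle, ⟨hyW, hy⟩, ?_⟩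
  have := A.matrixExtend_mono f le_rfl (inf_le_left : W ⊓ V' ≤ W) hWU hle hm
  rw [matrixRes_matrixRes] at this ⊢
  exact this

theorem pullbackSections_mem_of_locally_mem (A : Mold n d X) (f : Y ⟶ X) {V : Y.Opens}
    (m : Matrix (Fin n) (Fin n) Γ(Y, V))
    (hm : ∀ y ∈ V, ∃ (W : Y.Opens) (h : W ≤ V), y ∈ W ∧
      matrixRes Y n h m ∈ A.pullbackSections f W) :
    m ∈ A.pullbackSections f V := by
  intro y hy
  obtain ⟨W, hWV, hyW, h⟩ := hm y hy
  obtain ⟨U, W', hW', hU, hyW', h'⟩ := h y hyW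
  exact ⟨U, W', hW'.trans hWV, hU, hyW', by rwa [matrixRes_matrixRes] at h'⟩

theorem matrixExtend_le_pullbackSections (A : Mold n d X) (f : Y ⟶ X) {U : X.Opens} {V : Y.Opens}
    (h : V ≤ f ⁻¹ᵁ U) :
    matrixExtend (f.appLE U V h).hom (A.sections U) ≤ A.pullbackSections f V := by
  intro m hm y hy
  exact ⟨U, V, le_rfl, h, hy, A.matrixExtend_mono f le_rfl le_rfl h h hm⟩

/-- Where `A` has a basis on `U` which is part of a basis of `M_n(Γ(X, U))`, the pullback of the
latter is a basis of matrices on each `V ≤ f⁻¹ U`, adapted to the pullback of `A`. -/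
theorem exists_basis_pullback (A : Mold n d X) (f : Y ⟶ X) {U : X.Opens} {e : ℕ}
    (t : Module.Basis (Fin d ⊕ Fin e) Γ(X, U) (Matrix (Fin n) (Fin n) Γ(X, U)))
    (ht : ∀ (V : X.Opens) (h : V ≤ U),
      Submodule.span Γ(X, V) (Set.range fun i => matrixRes X n h (t (Sum.inl i))) =
        Subalgebra.toSubmodule (A.sections V))
    (V : Y.Opens) (hV : V ≤ f ⁻¹ᵁ U) :
    ∃ t' : Module.Basis (Fin d ⊕ Fin e) Γ(Y, V) (Matrix (Fin n) (Fin n) Γ(Y, V)),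
      (∀ k, t' k = (f.appLE U V hV).hom.mapMatrix (t k)) ∧
      Submodule.span Γ(Y, V) (Set.range fun i => t' (Sum.inl i)) =
        Subalgebra.toSubmodule (A.pullbackSections f V) := by
  obtain ⟨t', ht'⟩ := exists_basis_mapMatrix (f.appLE U V hV).hom t
  refine ⟨t', ht', le_antisymm ?_ ?_⟩
  · rw [Submodule.span_le]
    rintro _ ⟨i, rfl⟩
    simp only [ht']
    refine A.matrixExtend_le_pullbackSections f hV (mapMatrix_mem_matrixExtend _ ?_)
    have h1 : matrixRes X n le_rfl (t (Sum.inl i)) ∈ Subalgebra.toSubmodule (A.sections U) :=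
      ht U le_rfl ▸ Submodule.subset_span ⟨i, rfl⟩
    have h2 : matrixRes X n (le_refl U) (t (Sum.inl i)) = t (Sum.inl i) := by
      ext a b
      simp only [matrixRes, RingHom.mapMatrix_apply, Matrix.map_apply]
      exact ConcreteCategory.congr_hom (X.presheaf.map_id (op U)) _
    rw [h2] at h1
    exact h1
  · intro m hm
    have hz : ∀ j, t'.repr m (Sum.inr j) = 0 := by
      intro j
      refine eq_zero_of_locally_eq_zero _ fun y hy => ?_
      obtain ⟨U', W, hW, hWU, hyW, hmW⟩ := hm y hy
      refine ⟨W, hW, hyW, ?_⟩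
      have hle : W ≤ f ⁻¹ᵁ (U' ⊓ U) := fun z hz => ⟨hWU hz, hV (hW hz)⟩
      have h1 := A.matrixExtend_mono f (inf_le_left : U' ⊓ U ≤ U') le_rfl hWU hle hmW
      rw [matrixRes_matrixRes] at h1
      rw [← Subalgebra.mem_toSubmodule,
        matrixExtend_toSubmodule _ _ _ (ht (U' ⊓ U) inf_le_right)] at h1
      simp only [appLE_matrixRes] at h1
      obtain ⟨tW, htW⟩ := exists_basis_mapMatrix (f.appLE U W (hW.trans hV)).hom t
      have h2 : ∀ k, tW k = (Y.presheaf.map (homOfLE hW).op).hom.mapMatrix (t' k) := by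
        intro k
        rw [htW, ht']
        exact (matrixRes_appLE f hV hW (t k)).symm
      rw [← repr_mapMatrix _ t' tW h2 m]
      simp only [← htW] at h1
      rw [Set.range_comp' tW Sum.inl, Module.Basis.mem_span_image] at h1
      by_contra hne
      obtain ⟨i, hi⟩ := h1 (Finsupp.mem_support_iff.mpr hne)
      exact Sum.inl_ne_inr hi
    rw [← t'.sum_repr m, Fintype.sum_sum_type]
    simp only [hz, zero_smul, Finset.sum_const_zero, add_zero]
    exact Submodule.sum_mem _ fun i _ => Submodule.smul_mem _ _ (Submodule.subset_span ⟨i, rfl⟩)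

/-- The pullback of a mold along a morphism of schemes. -/
def pullback (A : Mold n d X) (f : Y ⟶ X) : Mold n d Y where
  sections := A.pullbackSections f
  res_mem h _ hm := A.pullbackSections_res_mem f h hm
  mem_of_locally_mem m hm := A.pullbackSections_mem_of_locally_mem f m hm
  locally_free y := by
    obtain ⟨U, hU, e, t, ht⟩ := A.exists_basis (f y)
    refine ⟨f ⁻¹ᵁ U, hU, fun i => (f.appLE U _ le_rfl).hom.mapMatrix (t (Sum.inl i)),
      fun V h => ?_⟩
    obtain ⟨t', ht', hs⟩ := A.exists_basis_pullback f t ht V h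
    simp only [matrixRes_appLE, ← ht']
    exact ⟨t'.linearIndependent.comp _ Sum.inl_injective, hs⟩
  quotient_locally_free y := by
    obtain ⟨U, hU, e, t, ht⟩ := A.exists_basis (f y)
    refine ⟨f ⁻¹ᵁ U, hU, e, fun i => (f.appLE U _ le_rfl).hom.mapMatrix (t (Sum.inr i)),
      fun V h => ?_⟩
    obtain ⟨t', ht', hs⟩ := A.exists_basis_pullback f t ht V h
    simp only [matrixRes_appLE, ← ht']
    rw [← hs]
    constructor
    · rw [Fintype.linearIndependent_iff]
      intro g hg j
      simp only [← map_smul, ← map_sum] at hg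
      rw [Submodule.mkQ_apply, Submodule.Quotient.mk_eq_zero, Set.range_comp' t' Sum.inl,
        Module.Basis.mem_span_image] at hg
      by_contra hne
      have h1 : t'.repr (∑ j, g j • t' (Sum.inr j)) (Sum.inr j) = g j := by
        simp [Finsupp.single_apply]
      obtain ⟨i, hi⟩ := hg (Finsupp.mem_support_iff.mpr (h1.symm ▸ hne))
      exact Sum.inl_ne_inr hi
    · rw [eq_top_iff]
      intro q _
      obtain ⟨m, rfl⟩ := Submodule.mkQ_surjective _ q
      rw [← t'.sum_repr m, Fintype.sum_sum_type, map_add, map_sum, map_sum]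
      refine add_mem (Submodule.sum_mem _ fun i _ => ?_) (Submodule.sum_mem _ fun j _ => ?_)
      · have h0 : (Submodule.span Γ(Y, V) (Set.range fun i => t' (Sum.inl i))).mkQ
            (t'.repr m (Sum.inl i) • t' (Sum.inl i)) = 0 := by
          rw [Submodule.mkQ_apply, Submodule.Quotient.mk_eq_zero]
          exact Submodule.smul_mem _ _ (Submodule.subset_span ⟨i, rfl⟩)
        rw [h0]
        exact zero_mem _
      · rw [map_smul]
        exact Submodule.smul_mem _ _ (Submodule.subset_span ⟨j, rfl⟩)

theorem pullback_id (A : Mold n d X) : A.pullback (𝟙 X) = A := by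
  have key : ∀ {U V : X.Opens} (h' : V ≤ 𝟙 X ⁻¹ᵁ U) (h : V ≤ U)
      (a : Matrix (Fin n) (Fin n) Γ(X, U)),
      (Scheme.Hom.appLE (𝟙 X) U V h').hom.mapMatrix a = matrixRes X n h a := by
    intro U V h' h a
    ext i j
    have h1 : Scheme.Hom.appLE (𝟙 X) U V h' = X.presheaf.map (homOfLE h).op := by
      rw [Scheme.Hom.appLE]
      exact Category.id_comp (X.presheaf.map (homOfLE h).op)
    exact congrArg (fun φ => φ.hom (a i j)) h1
  ext V m
  constructor
  · intro hm
    refine A.mem_of_locally_mem m fun x hx => ?_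
    obtain ⟨U, W, hWV, hWU, hxW, h⟩ := hm x hx
    refine ⟨W, hWV, hxW, matrixExtend_le _ (fun a ha => ?_) h⟩
    have h' : W ≤ U := hWU
    exact (key hWU h' a).symm ▸ A.res_mem h' ha
  · intro hm x hx
    have h' : V ≤ 𝟙 X ⁻¹ᵁ V := fun _ h => h
    exact ⟨V, V, le_rfl, h', hx, key h' le_rfl m ▸ mapMatrix_mem_matrixExtend _ hm⟩

theorem pullback_comp (A : Mold n d X) (g : Z ⟶ Y) (f : Y ⟶ X) :
    A.pullback (g ≫ f) = (A.pullback f).pullback g := by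
  ext V m
  constructor
  · intro hm z hz
    obtain ⟨U, W, hWV, hWU, hzW, h⟩ := hm z hz
    refine ⟨f ⁻¹ᵁ U, W, hWV, hWU, hzW, matrixExtend_le _ (fun a ha => ?_) h⟩
    rw [← appLE_appLE_mapMatrix g f (le_refl (f ⁻¹ᵁ U)) hWU]
    exact mapMatrix_mem_matrixExtend _ (A.matrixExtend_le_pullbackSections f le_rfl
      (mapMatrix_mem_matrixExtend _ ha))
  · intro hm
    refine A.pullbackSections_mem_of_locally_mem (g ≫ f) m fun z hz => ?_
    obtain ⟨V', W, hWV, hWV', hzW, h⟩ := hm z hz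
    refine ⟨W, hWV, hzW, matrixExtend_le _ (fun a ha => ?_) h⟩
    intro w hw
    obtain ⟨U, V'', hV'', hU, hwV'', h'⟩ := ha (g w) (hWV' hw)
    have hle : W ⊓ g ⁻¹ᵁ V'' ≤ g ⁻¹ᵁ V'' := inf_le_right
    refine ⟨U, W ⊓ g ⁻¹ᵁ V'', inf_le_left, hle.trans (g.preimage_mono hU), ⟨hw, hwV''⟩, ?_⟩
    rw [matrixRes_appLE, ← appLE_matrixRes g hle hV'']
    refine mapMatrix_mem_of_mem_matrixExtend _ _ (fun b hb => ?_) h'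
    have h1 := mapMatrix_mem_matrixExtend
      ((g ≫ f).appLE U (W ⊓ g ⁻¹ᵁ V'') (hle.trans (g.preimage_mono hU))).hom hb
    rw [← appLE_appLE_mapMatrix g f hU hle] at h1
    exact h1

/-- The fibre `A(x) = A ⊗ k(x) ⊆ M_n(k(x))` of a mold at a point `x`: the subalgebra generated by
the values at `x` of the sections of `A` around `x`. -/
def fiber (A : Mold n d X) (x : X) :
    Subalgebra (X.residueField x) (Matrix (Fin n) (Fin n) (X.residueField x)) :=
  ⨆ (U : X.Opens) (hx : x ∈ U), matrixExtend (X.evaluation U x hx).hom (A.sections U)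

end Mold

/-- The contravariant functor sending a scheme to the set of molds of degree `n` and rank `d` on it,
and a morphism to the pullback of molds. -/
def moldFunctor (n d : ℕ) : Scheme.{u}ᵒᵖ ⥤ Type u where
  obj X := Mold n d X.unop
  map f := ↾fun A => A.pullback f.unop
  map_id X := by
    apply ConcreteCategory.hom_ext
    exact fun A => Mold.pullback_id A
  map_comp f g := by
    apply ConcreteCategory.hom_ext
    exact fun A => Mold.pullback_comp A g.unop f.unop

/-- The universal mold on a scheme `M` representing the functor of molds: the one corresponding to
the identity of `M`. -/
def universalMold {n d : ℕ} {M : Scheme.{u}} (h : (moldFunctor.{u} n d).RepresentableBy M) :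
    Mold n d M :=
  h.homEquiv (𝟙 M)

/-- A morphism of schemes is smooth at a point `x` if its restriction to some open neighbourhood of
`x` is smooth. -/
def IsSmoothAt {X Y : Scheme.{u}} (f : X ⟶ Y) (x : X) : Prop :=
  ∃ U : X.Opens, x ∈ U ∧ Smooth (U.ι ≫ f)

end AlgebraicGeometry

end

/-! ### Affine charts: subalgebras of `M_n(S)` with prescribed complement -/

/-! Near a point, a mold has a basis one of whose maximal minors is invertible. Normalising that
minor to the identity presents the mold as the solutions of `m_c = ∑ₗ ξ_{cl} mₗ`, where `σ` splits
the `n²` matrix positions into `d` free and `e` dependent ones, and `ξ` is unique. The solutions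
form a subalgebra exactly when `1` and the products of the frame vectors are solutions (`IsMold`),
which are polynomial conditions on `ξ` over `ℤ`. Hence `Spec (ChartRing σ _)` represents the molds
with global coordinates for `σ`. Having such coordinates is an open condition compatible with
pullback, every mold has some locally, and molds glue, so the charts glue to a representing scheme
(`isRepresentable_moldFunctor`).

For smoothness, write the local ring of a chart at the point as `P/I`, with `P` a localised
polynomial ring in the `ξ_{cl}` and `I` the ideal of the mold equations. The Jacobian criterion
(`formallySmooth_of_exists_derivation`) asks that each `P`-linear `φ : I → k(x)` be the restriction
of a derivation `D : P → k(x)`; such a `D` may take any values on the `ξ_{cl}`.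

Applying `φ` to the defects of the products of frame vectors `bᵢ bⱼ` gives a Hochschild 2-cochain of
`A(x)` with values in `M_n/A(x)`. Computing the defect of `(bᵢ bⱼ) bₖ = bᵢ (bⱼ bₖ)` in two ways
shows that it is a cocycle (`d_obstructionCochain`). If it is `d g`, let `D ξ` be the coordinates of
the classes `g(bₗ)`. By the Leibniz rule `D` and `φ` agree on the equations for the products, and
agreement on the equations for `1` follows from this (`exists_derivation_eq`). -/

namespace MoldChart

noncomputable section

variable {n d e : ℕ} (σ : Fin d ⊕ Fin e ≃ Fin n × Fin n)
variable {S T : Type*} [CommRing S] [CommRing T]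

/-- The entry of a matrix at the position labelled by `k`. -/
abbrev entry (m : Matrix (Fin n) (Fin n) S) (k : Fin d ⊕ Fin e) : S := m (σ k).1 (σ k).2

/-- The matrix unit at the position labelled by `k`. -/
def unitMat (S : Type*) [CommRing S] (k : Fin d ⊕ Fin e) : Matrix (Fin n) (Fin n) S :=
  Matrix.single (σ k).1 (σ k).2 1

theorem entry_unitMat (k k' : Fin d ⊕ Fin e) :
    entry σ (unitMat σ S k) k' = if k = k' then 1 else 0 := by
  simp only [entry, unitMat, Matrix.single_apply, ← Prod.ext_iff, σ.injective.eq_iff]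

theorem ext_entry {S : Type*} {m m' : Matrix (Fin n) (Fin n) S} (h : ∀ k, entry σ m k = entry σ m' k) :
    m = m' := by
  ext i j
  simpa [entry] using h (σ.symm (i, j))

/-- The failure of `m` to satisfy the linear equations `m_c = ∑ₗ ξ_{cl} mₗ`, for `c` among the
dependent positions and `l` among the free ones. -/
def defect (ξ : Matrix (Fin e) (Fin d) S) : Matrix (Fin n) (Fin n) S →ₗ[S] (Fin e → S) where
  toFun m c := entry σ m (.inr c) - ∑ l, ξ c l * entry σ m (.inl l)
  map_add' m m' := by
    ext c
    simp only [entry, Matrix.add_apply, mul_add, Finset.sum_add_distrib, Pi.add_apply]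
    ring
  map_smul' r m := by
    ext c
    simp only [entry, Matrix.smul_apply, smul_eq_mul, RingHom.id_apply, Pi.smul_apply, mul_sub,
      Finset.mul_sum, mul_left_comm]

theorem defect_apply (ξ : Matrix (Fin e) (Fin d) S) (m : Matrix (Fin n) (Fin n) S) (c : Fin e) :
    defect σ ξ m c = entry σ m (.inr c) - ∑ l, ξ c l * entry σ m (.inl l) := rfl

/-- The solution of the linear equations attached to `ξ` whose free entries are those of a unit
vector. -/
def frame (ξ : Matrix (Fin e) (Fin d) S) (l : Fin d) : Matrix (Fin n) (Fin n) S :=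
  unitMat σ S (.inl l) + ∑ c, ξ c l • unitMat σ S (.inr c)

theorem entry_sum {ι : Type*} (s : Finset ι) (f : ι → Matrix (Fin n) (Fin n) S)
    (k : Fin d ⊕ Fin e) : entry σ (∑ i ∈ s, f i) k = ∑ i ∈ s, entry σ (f i) k :=
  Matrix.sum_apply _ _ _ _

theorem entry_frame_inl (ξ : Matrix (Fin e) (Fin d) S) (l i : Fin d) :
    entry σ (frame σ ξ l) (.inl i) = if l = i then 1 else 0 := by
  have h := entry_unitMat σ (S := S)
  rw [frame]
  change entry σ (unitMat σ S (.inl l)) (.inl i) + entry σ _ (.inl i) = _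
  rw [entry_sum, h]
  simp only [entry, Matrix.smul_apply] at h ⊢
  simp [h]

theorem entry_frame_inr (ξ : Matrix (Fin e) (Fin d) S) (l : Fin d) (c : Fin e) :
    entry σ (frame σ ξ l) (.inr c) = ξ c l := by
  have h := entry_unitMat σ (S := S)
  rw [frame]
  change entry σ (unitMat σ S (.inl l)) (.inr c) + entry σ _ (.inr c) = _
  rw [entry_sum, h]
  simp only [entry, Matrix.smul_apply] at h ⊢
  simp [h]

theorem defect_frame (ξ : Matrix (Fin e) (Fin d) S) (l : Fin d) : defect σ ξ (frame σ ξ l) = 0 := by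
  ext c
  simp [defect_apply, entry_frame_inl, entry_frame_inr]

theorem defect_unitMat_inr (ξ : Matrix (Fin e) (Fin d) S) (c : Fin e) :
    defect σ ξ (unitMat σ S (.inr c)) = Pi.single c 1 := by
  ext c'
  simp [defect_apply, entry_unitMat, Pi.single_apply, eq_comm]

/-- Every matrix is a combination of the frame, up to its defect. -/
theorem eq_sum_frame_add (ξ : Matrix (Fin e) (Fin d) S) (m : Matrix (Fin n) (Fin n) S) :
    m = ∑ l, entry σ m (.inl l) • frame σ ξ l + ∑ c, defect σ ξ m c • unitMat σ S (.inr c) := by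
  refine ext_entry σ fun k => ?_
  change _ = entry σ (∑ l, entry σ m (.inl l) • frame σ ξ l) k +
    entry σ (∑ c, defect σ ξ m c • unitMat σ S (.inr c)) k
  rw [entry_sum, entry_sum]
  change _ = ∑ l, entry σ m (.inl l) * entry σ (frame σ ξ l) k +
    ∑ c, defect σ ξ m c * entry σ (unitMat σ S (.inr c)) k
  rcases k with i | c
  · simp [entry_frame_inl, entry_unitMat]
  · simp [entry_frame_inr, entry_unitMat, defect_apply, mul_comm]

theorem eq_sum_frame {ξ : Matrix (Fin e) (Fin d) S} {m : Matrix (Fin n) (Fin n) S}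
    (h : defect σ ξ m = 0) : m = ∑ l, entry σ m (.inl l) • frame σ ξ l := by
  conv_lhs => rw [eq_sum_frame_add σ ξ m]
  simp [h]

theorem defect_sum_smul_frame (ξ : Matrix (Fin e) (Fin d) S) (a : Fin d → S) :
    defect σ ξ (∑ l, a l • frame σ ξ l) = 0 := by
  simp [map_sum, defect_frame]

/-- The equations on `ξ` which say that the solutions of the linear equations attached to `ξ` form
a subalgebra. -/
structure IsMold (ξ : Matrix (Fin e) (Fin d) S) : Prop where
  one : defect σ ξ 1 = 0
  mul (i j : Fin d) : defect σ ξ (frame σ ξ i * frame σ ξ j) = 0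

variable {σ}

theorem IsMold.defect_mul {ξ : Matrix (Fin e) (Fin d) S} (h : IsMold σ ξ)
    {m m' : Matrix (Fin n) (Fin n) S} (hm : defect σ ξ m = 0) (hm' : defect σ ξ m' = 0) :
    defect σ ξ (m * m') = 0 := by
  rw [eq_sum_frame σ hm, eq_sum_frame σ hm', Finset.sum_mul_sum]
  simp [map_sum, h.mul]

/-- The subalgebra of solutions of the linear equations attached to `ξ`. -/
def IsMold.toSubalgebra {ξ : Matrix (Fin e) (Fin d) S} (h : IsMold σ ξ) :
    Subalgebra S (Matrix (Fin n) (Fin n) S) where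
  carrier := {m | defect σ ξ m = 0}
  mul_mem' hm hm' := h.defect_mul hm hm'
  add_mem' hm hm' := by
    simp only [Set.mem_ofPred_eq] at hm hm' ⊢
    rw [map_add, hm, hm', add_zero]
  algebraMap_mem' r := by
    simp [Algebra.algebraMap_eq_smul_one, h.one]

theorem IsMold.mem_toSubalgebra {ξ : Matrix (Fin e) (Fin d) S} (h : IsMold σ ξ)
    {m : Matrix (Fin n) (Fin n) S} : m ∈ h.toSubalgebra ↔ defect σ ξ m = 0 := Iff.rfl

/-- The frame vectors are themselves solutions, so they and their products lie in the subalgebra. -/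
theorem isMold_of_mem_iff {ξ : Matrix (Fin e) (Fin d) S}
    (A : Subalgebra S (Matrix (Fin n) (Fin n) S)) (hA : ∀ m, m ∈ A ↔ defect σ ξ m = 0) :
    IsMold σ ξ where
  one := (hA 1).1 A.one_mem
  mul i j := (hA _).1 (A.mul_mem ((hA _).2 (defect_frame σ ξ i)) ((hA _).2 (defect_frame σ ξ j)))

/-- The coordinates are determined by the solutions of the linear equations. -/
theorem coord_eq_of_defect_eq_zero {ξ η : Matrix (Fin e) (Fin d) S}
    (h : ∀ m, defect σ ξ m = 0 → defect σ η m = 0) : ξ = η := by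
  ext c l
  have h1 := congrFun (h _ (defect_frame σ ξ l)) c
  simp only [defect_apply, entry_frame_inr, entry_frame_inl, mul_ite, mul_one, mul_zero,
    Finset.sum_ite_eq, Finset.mem_univ, if_true, Pi.zero_apply] at h1
  exact sub_eq_zero.1 h1

variable (σ)

/-- Defects and frames are given by universal polynomial formulas. Their compatibility with ring
homomorphisms covers restriction to smaller opens, pullback, evaluation at a point and reduction
modulo `moldIdeal` alike. -/
theorem map_defect (φ : S →+* T) (ξ : Matrix (Fin e) (Fin d) S) (m : Matrix (Fin n) (Fin n) S)
    (c : Fin e) : φ (defect σ ξ m c) = defect σ (ξ.map φ) (φ.mapMatrix m) c := by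
  simp [defect_apply, entry]

theorem map_unitMat (φ : S →+* T) (k : Fin d ⊕ Fin e) :
    φ.mapMatrix (unitMat σ S k) = unitMat σ T k := by
  simp [unitMat, Matrix.map_single]

theorem map_frame (φ : S →+* T) (ξ : Matrix (Fin e) (Fin d) S) (l : Fin d) :
    φ.mapMatrix (frame σ ξ l) = frame σ (ξ.map φ) l := by
  simp only [frame, map_add, map_sum, mapMatrix_smul', map_unitMat, Matrix.map_apply]

theorem defect_map_eq_zero (φ : S →+* T) {ξ : Matrix (Fin e) (Fin d) S}
    {m : Matrix (Fin n) (Fin n) S} (h : defect σ ξ m = 0) :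
    defect σ (ξ.map φ) (φ.mapMatrix m) = 0 := by
  ext c
  rw [← map_defect, h]
  simp

/-- Serves to descend the equations along open immersions, whose comorphisms on sections over opens
in the range are isomorphisms. -/
theorem defect_eq_zero_of_map (φ : S →+* T) (hφ : Function.Injective φ)
    {ξ : Matrix (Fin e) (Fin d) S} {m : Matrix (Fin n) (Fin n) S}
    (h : defect σ (ξ.map φ) (φ.mapMatrix m) = 0) : defect σ ξ m = 0 := by
  ext c
  apply hφ
  rw [map_defect, h]
  simp

variable {σ}

theorem IsMold.map (φ : S →+* T) {ξ : Matrix (Fin e) (Fin d) S} (h : IsMold σ ξ) :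
    IsMold σ (ξ.map φ) where
  one := by simpa using defect_map_eq_zero σ φ h.one
  mul i j := by
    rw [← map_frame, ← map_frame, ← map_mul]
    exact defect_map_eq_zero σ φ (h.mul i j)

/-- A matrix over a field with linearly independent rows has a maximal family of linearly independent
columns indexed like its rows. -/
theorem exists_injective_linearIndependent_col {K ι : Type*} [Field K] [Fintype ι] {d : ℕ}
    (N : Matrix (Fin d) ι K) (hN : LinearIndependent K N.row) :
    ∃ a : Fin d → ι, Function.Injective a ∧ LinearIndependent K (N.col ∘ a) := by
  -- Row rank equals column rank, so a maximal independent family of columns has exactly `d`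
  -- members.
  have hr : N.rank = d := by simpa using hN.rank_matrix
  rw [Matrix.rank_eq_finrank_span_cols] at hr
  obtain ⟨κ, a, ha, hs, hli⟩ := exists_linearIndependent' K N.col
  have : Finite κ := Finite.of_injective a ha
  have := Fintype.ofFinite κ
  have hκ : Fintype.card κ = d := by
    rw [← hr, ← hs, finrank_span_eq_card hli]
  let ε : Fin d ≃ κ := (Fintype.equivFinOfCardEq hκ).symm
  exact ⟨a ∘ ε, ha.comp ε.injective, hli.comp ε ε.injective⟩

theorem exists_equiv_sum_extending {ι : Type*} [Fintype ι] {d : ℕ} (a : Fin d → ι)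
    (ha : Function.Injective a) :
    ∃ (e : ℕ) (σ : Fin d ⊕ Fin e ≃ ι), ∀ i, σ (.inl i) = a i := by
  classical
  refine ⟨_, (Equiv.sumCongr (Equiv.ofInjective a ha) (Fintype.equivFin _).symm).trans
    (Equiv.Set.sumCompl (Set.range a)), fun i => ?_⟩
  simp

/-- Linearly independent matrices over a field have a nonzero maximal minor. -/
theorem exists_det_ne_zero {n d : ℕ} {K : Type*} [Field K] (v : Fin d → Matrix (Fin n) (Fin n) K)
    (hv : LinearIndependent K v) : ∃ (e : ℕ) (σ : Fin d ⊕ Fin e ≃ Fin n × Fin n),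
      (Matrix.of fun i l => entry σ (v i) (.inl l)).det ≠ 0 := by
  -- The matrices become the rows of a `d × n²` matrix; the independent columns found are the free
  -- positions.
  obtain ⟨a, ha, hli⟩ := exists_injective_linearIndependent_col
    (Matrix.of fun i (p : Fin n × Fin n) => v i p.1 p.2)
    (by
      rw [Fintype.linearIndependent_iff] at hv ⊢
      intro g hg
      refine hv g ?_
      ext i j
      simpa [Matrix.sum_apply, Matrix.row] using congrFun hg (i, j))
  obtain ⟨e, σ, hσ⟩ := exists_equiv_sum_extending a ha
  refine ⟨e, σ, ?_⟩
  refine ((Matrix.isUnit_iff_isUnit_det _).1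
    (Matrix.linearIndependent_cols_iff_isUnit.1 ?_)).ne_zero
  convert hli using 1
  ext l i
  simp [entry, hσ]

end

end MoldChart

/-! ### First order deformations of a chart -/

namespace HochschildCochain

variable {K : Type*} [CommRing K] {A : Type*} [Ring A] [Algebra K A]
  {M : Type*} [AddCommGroup M] [Module K M] [Module A M] [Module Aᵐᵒᵖ M]
  [IsScalarTower K A M] [IsScalarTower K Aᵐᵒᵖ M]

theorem d_one_apply (g : HochschildCochain K A M 1) (a b : A) :
    d K A M 1 g ![a, b] = a • g ![b] - g ![a * b] + MulOpposite.op b • g ![a] := by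
  have h : Fin.contractNth (Fin.castSucc (0 : Fin 1)) (· * ·) ![a, b] = ![a * b] := by
    ext i; fin_cases i; rfl
  have hi : Fin.init ![a, b] = ![a] := by ext i; fin_cases i; rfl
  have ht : Fin.tail ![a, b] = ![b] := by ext i; fin_cases i; rfl
  change (leftTerm g + ∑ j : Fin 1, (-1 : K) ^ ((j : ℕ) + 1) • middleTerm j g
    + (-1 : K) ^ (1 + 1) • rightTerm g) ![a, b] = _
  simp [leftTerm, rightTerm, middleTerm, hi, ht, sub_eq_add_neg]
  congr 1

theorem d_two_apply (f : HochschildCochain K A M 2) (a b c : A) :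
    d K A M 2 f ![a, b, c] = a • f ![b, c] - f ![a * b, c] + f ![a, b * c]
      - MulOpposite.op c • f ![a, b] := by
  have h0 : Fin.contractNth (Fin.castSucc (0 : Fin 2)) (· * ·) ![a, b, c] = ![a * b, c] := by
    ext i; fin_cases i <;> rfl
  have h1 : Fin.contractNth (Fin.castSucc (1 : Fin 2)) (· * ·) ![a, b, c] = ![a, b * c] := by
    ext i; fin_cases i <;> rfl
  have hi : Fin.init ![a, b, c] = ![a, b] := by ext i; fin_cases i <;> rfl
  have ht : Fin.tail ![a, b, c] = ![b, c] := by ext i; fin_cases i <;> rfl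
  have hl : ![a, b, c] (Fin.last 2) = c := rfl
  change (leftTerm f + ∑ j : Fin 2, (-1 : K) ^ ((j : ℕ) + 1) • middleTerm j f
    + (-1 : K) ^ (2 + 1) • rightTerm f) ![a, b, c] = _
  simp only [leftTerm, middleTerm, rightTerm, Fin.sum_univ_two, add_apply,
    smul_apply, MultilinearMap.coe_mk, hi, ht, h0, h1, hl]
  simp [pow_succ, sub_eq_add_neg, add_assoc]

theorem exists_d_eq_of_subsingleton [SMulCommClass A Aᵐᵒᵖ M] (p : ℕ)
    (h : Subsingleton (HochschildCohomology K A M (p + 1)))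
    (f : HochschildCochain K A M (p + 1)) (hf : d K A M (p + 1) f = 0) :
    ∃ g, d K A M p g = f := by
  have h1 := (Submodule.Quotient.mk_eq_zero _).1
    (Subsingleton.elim (Submodule.Quotient.mk (⟨f, hf⟩ : cocycles K A M (p + 1)) :
      HochschildCohomology K A M (p + 1)) 0)
  exact h1

end HochschildCochain

namespace MoldChart

noncomputable section

variable {n d e : ℕ} (σ : Fin d ⊕ Fin e ≃ Fin n × Fin n)

/-- The ideal generated by the equations in `IsMold`. -/
def moldIdeal {P : Type*} [CommRing P] (ξ : Matrix (Fin e) (Fin d) P) : Ideal P :=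
  Ideal.span (Set.range (defect σ ξ 1) ∪
    Set.range fun t : Fin d × Fin d × Fin e =>
      defect σ ξ (frame σ ξ t.1 * frame σ ξ t.2.1) t.2.2)

section

variable {P : Type*} [CommRing P] (ξ : Matrix (Fin e) (Fin d) P)

theorem defect_one_mem_moldIdeal (c : Fin e) : defect σ ξ 1 c ∈ moldIdeal σ ξ :=
  Ideal.subset_span (Or.inl ⟨c, rfl⟩)

theorem defect_mul_mem_moldIdeal (i j : Fin d) (c : Fin e) :
    defect σ ξ (frame σ ξ i * frame σ ξ j) c ∈ moldIdeal σ ξ :=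
  Ideal.subset_span (Or.inr ⟨(i, j, c), rfl⟩)

theorem moldIdeal_le_iff (I : Ideal P) :
    moldIdeal σ ξ ≤ I ↔ (∀ c, defect σ ξ 1 c ∈ I) ∧
      ∀ i j c, defect σ ξ (frame σ ξ i * frame σ ξ j) c ∈ I := by
  refine ⟨fun h => ⟨fun c => h (defect_one_mem_moldIdeal σ ξ c),
    fun i j c => h (defect_mul_mem_moldIdeal σ ξ i j c)⟩, fun h => ?_⟩
  rw [moldIdeal, Ideal.span_le, Set.union_subset_iff, Set.range_subset_iff, Set.range_subset_iff]
  exact ⟨h.1, fun t => h.2 _ _ _⟩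

/-- The universal property of the quotient by `moldIdeal`: homomorphisms killing the ideal are those
that make the image of `ξ` the coordinates of a subalgebra. -/
theorem isMold_map_iff {T : Type*} [CommRing T] (φ : P →+* T) :
    IsMold σ (ξ.map φ) ↔ moldIdeal σ ξ ≤ RingHom.ker φ := by
  rw [moldIdeal_le_iff]
  simp only [RingHom.mem_ker, map_defect, map_mul, map_frame, map_one]
  exact ⟨fun h => ⟨fun c => congrFun h.one c, fun i j c => congrFun (h.mul i j) c⟩,
    fun h => ⟨funext h.1, fun i j => funext (h.2 i j)⟩⟩

/-- Allows the equations of a chart to be read in a localisation of the polynomial ring. -/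
theorem map_moldIdeal {T : Type*} [CommRing T] (φ : P →+* T) :
    (moldIdeal σ ξ).map φ = moldIdeal σ (ξ.map φ) := by
  refine le_antisymm ?_ ?_
  · rw [Ideal.map_le_iff_le_comap, moldIdeal_le_iff]
    simp only [Ideal.mem_comap, map_defect, map_mul, map_frame, map_one]
    exact ⟨defect_one_mem_moldIdeal σ _, defect_mul_mem_moldIdeal σ _⟩
  · rw [moldIdeal_le_iff]
    refine ⟨fun c => ?_, fun i j c => ?_⟩
    · have := Ideal.mem_map_of_mem φ (defect_one_mem_moldIdeal σ ξ c)
      rwa [map_defect, map_one] at this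
    · have := Ideal.mem_map_of_mem φ (defect_mul_mem_moldIdeal σ ξ i j c)
      rwa [map_defect, map_mul, map_frame, map_frame] at this

theorem moldIdeal_fg : (moldIdeal σ ξ).FG :=
  Submodule.fg_span ((Set.finite_range _).union (Set.finite_range _))

/-- The matrices which solve the linear equations attached to `ξ` modulo `moldIdeal`. -/
def approx : Submodule P (Matrix (Fin n) (Fin n) P) :=
  (Submodule.pi Set.univ fun _ : Fin e => moldIdeal σ ξ).comap (defect σ ξ)

variable {ξ}

theorem mem_approx {m : Matrix (Fin n) (Fin n) P} :
    m ∈ approx σ ξ ↔ ∀ c, defect σ ξ m c ∈ moldIdeal σ ξ := by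
  simp [approx, Submodule.mem_pi]

theorem mem_approx_iff_defect_map {m : Matrix (Fin n) (Fin n) P} :
    m ∈ approx σ ξ ↔ defect σ (ξ.map (Ideal.Quotient.mk (moldIdeal σ ξ)))
      ((Ideal.Quotient.mk (moldIdeal σ ξ)).mapMatrix m) = 0 := by
  rw [mem_approx, funext_iff]
  simp only [← map_defect, Pi.zero_apply, Ideal.Quotient.eq_zero_iff_mem]

theorem one_mem_approx : (1 : Matrix (Fin n) (Fin n) P) ∈ approx σ ξ :=
  (mem_approx σ).2 (defect_one_mem_moldIdeal σ ξ)

theorem frame_mem_approx (l : Fin d) : frame σ ξ l ∈ approx σ ξ := by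
  simp [mem_approx, defect_frame]

/-- Modulo `moldIdeal` the coordinates do define a subalgebra, and `approx` is its preimage. -/
theorem mul_mem_approx {m m' : Matrix (Fin n) (Fin n) P} (hm : m ∈ approx σ ξ)
    (hm' : m' ∈ approx σ ξ) : m * m' ∈ approx σ ξ := by
  rw [mem_approx_iff_defect_map] at *
  rw [map_mul]
  exact ((isMold_map_iff σ ξ _).2 Ideal.mk_ker.ge).defect_mul hm hm'

theorem smul_mem_approx {r : P} (hr : r ∈ moldIdeal σ ξ) (m : Matrix (Fin n) (Fin n) P) :
    r • m ∈ approx σ ξ := by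
  rw [mem_approx]
  intro c
  rw [map_smul]
  exact Ideal.mul_mem_right _ _ hr

end

/-! ### The fibre algebra and its quotient bimodule in coordinates. -/

section Fiber

variable {K : Type*} [Field K] (A : Subalgebra K (Matrix (Fin n) (Fin n) K))
  {ξ : Matrix (Fin e) (Fin d) K} (hA : ∀ m, m ∈ A ↔ defect σ ξ m = 0)

/-- The frame attached to `ξ`, as a basis of the subalgebra of solutions. -/
def frameBasis : Module.Basis (Fin d) K A :=
  .ofEquivFun
    { toFun := fun a l => entry σ (a : Matrix (Fin n) (Fin n) K) (.inl l)
      map_add' := fun _ _ => rfl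
      map_smul' := fun _ _ => rfl
      invFun := fun v => ⟨∑ l, v l • frame σ ξ l, (hA _).2 (defect_sum_smul_frame σ ξ v)⟩
      left_inv := fun a => Subtype.ext (eq_sum_frame σ ((hA _).1 a.2)).symm
      right_inv := fun v => by
        ext i
        change entry σ (∑ l, v l • frame σ ξ l) (.inl i) = v i
        rw [entry_sum]
        change ∑ l, v l * entry σ (frame σ ξ l) (.inl i) = v i
        simp [entry_frame_inl] }

theorem coe_frameBasis (l : Fin d) :
    (frameBasis σ A hA l : Matrix (Fin n) (Fin n) K) = frame σ ξ l := by
  rw [frameBasis, Module.Basis.coe_ofEquivFun]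
  change ∑ l', (Pi.single l 1 : Fin d → K) l' • frame σ ξ l' = _
  simp [Pi.single_apply]

theorem frameBasis_repr (a : A) (l : Fin d) :
    (frameBasis σ A hA).repr a l = entry σ (a : Matrix (Fin n) (Fin n) K) (.inl l) := by
  rw [← Module.Basis.equivFun_apply, frameBasis, Module.Basis.equivFun_ofEquivFun]
  rfl

include hA in
-- The classes of the matrix units at the dependent positions form a basis of `M_n(K)/A`, in which
-- the defects are the coordinates. Spanning is proved here, independence in
-- `eq_zero_of_sum_smul_mk`.
theorem mk_eq_sum_defect (m : Matrix (Fin n) (Fin n) K) :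
    (Submodule.Quotient.mk m : Matrix (Fin n) (Fin n) K ⧸ Subalgebra.toSubmodule A) =
      ∑ c, defect σ ξ m c • Submodule.Quotient.mk (unitMat σ K (.inr c)) := by
  have h : ∑ c, defect σ ξ m c • (Submodule.Quotient.mk (unitMat σ K (.inr c)) :
      Matrix (Fin n) (Fin n) K ⧸ Subalgebra.toSubmodule A) =
      Submodule.Quotient.mk (∑ c, defect σ ξ m c • unitMat σ K (.inr c)) := by
    simp only [← Submodule.mkQ_apply, map_sum, map_smul]
  rw [h, Submodule.Quotient.eq]
  have h2 : m - ∑ c, defect σ ξ m c • unitMat σ K (.inr c) =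
      ∑ l, entry σ m (.inl l) • frame σ ξ l :=
    sub_eq_of_eq_add (eq_sum_frame_add σ ξ m)
  rw [h2]
  exact (hA _).2 (defect_sum_smul_frame σ ξ _)

include hA in
theorem eq_zero_of_sum_smul_mk {a : Fin e → K}
    (h : ∑ c, a c • (Submodule.Quotient.mk (unitMat σ K (.inr c)) :
      Matrix (Fin n) (Fin n) K ⧸ Subalgebra.toSubmodule A) = 0) : a = 0 := by
  have h1 : Submodule.Quotient.mk (p := Subalgebra.toSubmodule A)
      (∑ c, a c • unitMat σ K (.inr c)) = 0 := by
    rw [← h]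
    simp only [← Submodule.mkQ_apply, map_sum, map_smul]
  rw [Submodule.Quotient.mk_eq_zero] at h1
  have h2 := (hA _).1 h1
  simp only [map_sum, map_smul, defect_unitMat_inr] at h2
  rw [← h2]
  ext c
  simp [Pi.single_apply]

end Fiber

end

end MoldChart

/-! ### The obstruction cocycle attached to a functional on the mold ideal. -/

namespace MoldChart

noncomputable section

variable {n d e : ℕ} (σ : Fin d ⊕ Fin e ≃ Fin n × Fin n)

section Obstruction

variable {P : Type*} [CommRing P] {K : Type*} [Field K] [Algebra P K]
  (ξ : Matrix (Fin e) (Fin d) P) (A : Subalgebra K (Matrix (Fin n) (Fin n) K))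
  (φ : moldIdeal σ ξ →ₗ[P] K)

/-- The class in `M_n(K)/A` of the defect of a matrix, measured by a functional on `moldIdeal`. -/
def obstruction : approx σ ξ →ₗ[P] (Matrix (Fin n) (Fin n) K ⧸ Subalgebra.toSubmodule A) where
  toFun m := ∑ c, φ ⟨defect σ ξ m c, (mem_approx σ).1 m.2 c⟩ •
    Submodule.Quotient.mk (unitMat σ K (.inr c))
  map_add' m m' := by
    rw [← Finset.sum_add_distrib]
    refine Finset.sum_congr rfl fun c _ => ?_
    rw [← add_smul, ← map_add]
    congr 2
    exact Subtype.ext (congrFun (map_add (defect σ ξ) (m : Matrix _ _ P) m') c)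
  map_smul' r m := by
    rw [Finset.smul_sum]
    refine Finset.sum_congr rfl fun c _ => ?_
    rw [RingHom.id_apply, ← smul_assoc, ← map_smul]
    congr 2
    exact Subtype.ext (congrFun (map_smul (defect σ ξ) r (m : Matrix _ _ P)) c)

theorem obstruction_apply (m : approx σ ξ) :
    obstruction σ ξ A φ m = ∑ c, φ ⟨defect σ ξ m c, (mem_approx σ).1 m.2 c⟩ •
      Submodule.Quotient.mk (unitMat σ K (.inr c)) := rfl

theorem obstruction_frame (l : Fin d) :
    obstruction σ ξ A φ ⟨frame σ ξ l, frame_mem_approx σ l⟩ = 0 := by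
  rw [obstruction_apply]
  refine Finset.sum_eq_zero fun c _ => ?_
  have : (⟨defect σ ξ (frame σ ξ l) c, (mem_approx σ).1 (frame_mem_approx σ l) c⟩ :
      moldIdeal σ ξ) = 0 := Subtype.ext (congrFun (defect_frame σ ξ l) c)
  rw [this, map_zero, zero_smul]

variable {A} (hA : ∀ m, m ∈ A ↔ defect σ (ξ.map (algebraMap P K)) m = 0)

include hA in
-- The image of `ξ` in `K` consists of coordinates of the algebra `A`, so it satisfies the mold
-- equations.
theorem algebraMap_eq_zero_of_mem {r : P} (hr : r ∈ moldIdeal σ ξ) : algebraMap P K r = 0 :=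
  (isMold_map_iff σ ξ (algebraMap P K)).1 (isMold_of_mem_iff A hA) hr

include hA in
theorem mapMatrix_mem_of_mem_approx {m : Matrix (Fin n) (Fin n) P} (hm : m ∈ approx σ ξ) :
    (algebraMap P K).mapMatrix m ∈ A := by
  rw [hA]
  ext c
  rw [← map_defect]
  exact algebraMap_eq_zero_of_mem σ ξ hA ((mem_approx σ).1 hm c)

include hA in
-- By `P`-linearity of `φ`, the factor `defect σ ξ m c` comes out through `P → K`, and the remaining
-- sum is the class of the reduced matrix. This evaluates the error terms that arise when products
-- are expanded in the frame.
theorem obstruction_smul (r : moldIdeal σ ξ) (m : Matrix (Fin n) (Fin n) P) :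
    obstruction σ ξ A φ ⟨(r : P) • m, smul_mem_approx σ r.2 m⟩ =
      φ r • Submodule.Quotient.mk ((algebraMap P K).mapMatrix m) := by
  rw [obstruction_apply, mk_eq_sum_defect σ A hA, Finset.smul_sum]
  refine Finset.sum_congr rfl fun c _ => ?_
  have : (⟨defect σ ξ ((r : P) • m) c, (mem_approx σ).1 (smul_mem_approx σ r.2 m) c⟩ :
      moldIdeal σ ξ) = defect σ ξ m c • r := by
    apply Subtype.ext
    simp [mul_comm]
  rw [this, map_smul, ← map_defect, smul_smul, Algebra.smul_def, mul_comm]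

include hA in
/-- The class of a product `m * m'` with `m` written as a combination of the frame and an error
term in `moldIdeal`. -/
theorem obstruction_mul_right {m m' : Matrix (Fin n) (Fin n) P} (hm : m ∈ approx σ ξ)
    (hm' : m' ∈ approx σ ξ) :
    obstruction σ ξ A φ ⟨m * m', mul_mem_approx σ hm hm'⟩ =
      ∑ l, entry σ m (.inl l) • obstruction σ ξ A φ
        ⟨frame σ ξ l * m', mul_mem_approx σ (frame_mem_approx σ l) hm'⟩ +
      MulOpposite.op (⟨_, mapMatrix_mem_of_mem_approx σ ξ hA hm'⟩ : A) •
        obstruction σ ξ A φ ⟨m, hm⟩ := by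
  have h : (⟨m * m', mul_mem_approx σ hm hm'⟩ : approx σ ξ) =
      ∑ l, entry σ m (.inl l) •
        ⟨frame σ ξ l * m', mul_mem_approx σ (frame_mem_approx σ l) hm'⟩ +
      ∑ c, ⟨defect σ ξ m c • (unitMat σ P (.inr c) * m'),
        smul_mem_approx σ ((mem_approx σ).1 hm c) _⟩ := by
    apply Subtype.ext
    simp only [Submodule.coe_add, Submodule.coe_sum, Submodule.coe_smul]
    conv_lhs => rw [eq_sum_frame_add σ ξ m, add_mul, Finset.sum_mul, Finset.sum_mul]
    simp only [smul_mul_assoc]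
  rw [h, map_add, map_sum, map_sum]
  congr 1
  · simp only [map_smul]
  · rw [obstruction_apply, Finset.smul_sum]
    refine Finset.sum_congr rfl fun c _ => ?_
    rw [obstruction_smul σ ξ φ hA ⟨_, (mem_approx σ).1 hm c⟩, smul_comm, map_mul, map_unitMat]
    rfl

include hA in
-- Mirror image of `obstruction_mul_right`: the right factor is expanded, so its error term acquires
-- a left multiplication.
theorem obstruction_mul_left {m m' : Matrix (Fin n) (Fin n) P} (hm : m ∈ approx σ ξ)
    (hm' : m' ∈ approx σ ξ) :
    obstruction σ ξ A φ ⟨m * m', mul_mem_approx σ hm hm'⟩ =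
      ∑ l, entry σ m' (.inl l) • obstruction σ ξ A φ
        ⟨m * frame σ ξ l, mul_mem_approx σ hm (frame_mem_approx σ l)⟩ +
      (⟨_, mapMatrix_mem_of_mem_approx σ ξ hA hm⟩ : A) • obstruction σ ξ A φ ⟨m', hm'⟩ := by
  have h : (⟨m * m', mul_mem_approx σ hm hm'⟩ : approx σ ξ) =
      ∑ l, entry σ m' (.inl l) •
        ⟨m * frame σ ξ l, mul_mem_approx σ hm (frame_mem_approx σ l)⟩ +
      ∑ c, ⟨defect σ ξ m' c • (m * unitMat σ P (.inr c)),
        smul_mem_approx σ ((mem_approx σ).1 hm' c) _⟩ := by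
    apply Subtype.ext
    simp only [Submodule.coe_add, Submodule.coe_sum, Submodule.coe_smul]
    conv_lhs => rw [eq_sum_frame_add σ ξ m', mul_add, Finset.mul_sum, Finset.mul_sum]
    simp only [mul_smul_comm]
  rw [h, map_add, map_sum, map_sum]
  congr 1
  · simp only [map_smul]
  · rw [obstruction_apply, Finset.smul_sum]
    refine Finset.sum_congr rfl fun c _ => ?_
    rw [obstruction_smul σ ξ φ hA ⟨_, (mem_approx σ).1 hm' c⟩, smul_comm, map_mul, map_unitMat]
    rfl

/-- The obstruction to lifting the multiplication, as a Hochschild cochain. -/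
def obstructionCochain : HochschildCochain K A
    (Matrix (Fin n) (Fin n) K ⧸ Subalgebra.toSubmodule A) 2 :=
  ∑ i, ∑ j, ((MultilinearMap.mkPiAlgebra K (Fin 2) K).compLinearMap
    ![(frameBasis σ A hA).coord i, (frameBasis σ A hA).coord j]).smulRight
      (obstruction σ ξ A φ ⟨frame σ ξ i * frame σ ξ j,
        mul_mem_approx σ (frame_mem_approx σ i) (frame_mem_approx σ j)⟩)

theorem obstructionCochain_apply (a b : A) :
    obstructionCochain σ ξ φ hA ![a, b] =
      ∑ i, ∑ j, (entry σ (a : Matrix (Fin n) (Fin n) K) (.inl i) *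
          entry σ (b : Matrix (Fin n) (Fin n) K) (.inl j)) •
        obstruction σ ξ A φ ⟨frame σ ξ i * frame σ ξ j,
          mul_mem_approx σ (frame_mem_approx σ i) (frame_mem_approx σ j)⟩ := by
  rw [obstructionCochain, sum_apply]
  refine Finset.sum_congr rfl fun i _ => ?_
  rw [sum_apply]
  refine Finset.sum_congr rfl fun j _ => ?_
  simp [Fin.prod_univ_two, frameBasis_repr]

theorem entry_frameBasis (k l : Fin d) :
    entry σ (frameBasis σ A hA k : Matrix (Fin n) (Fin n) K) (.inl l) = if k = l then 1 else 0 := by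
  rw [coe_frameBasis, entry_frame_inl]

theorem obstructionCochain_frame_right (a : A) (k : Fin d) :
    obstructionCochain σ ξ φ hA ![a, frameBasis σ A hA k] =
      ∑ l, entry σ (a : Matrix (Fin n) (Fin n) K) (.inl l) •
        obstruction σ ξ A φ ⟨frame σ ξ l * frame σ ξ k,
          mul_mem_approx σ (frame_mem_approx σ l) (frame_mem_approx σ k)⟩ := by
  simp [obstructionCochain_apply, entry_frameBasis]

theorem obstructionCochain_frame_left (a : A) (k : Fin d) :
    obstructionCochain σ ξ φ hA ![frameBasis σ A hA k, a] =
      ∑ l, entry σ (a : Matrix (Fin n) (Fin n) K) (.inl l) •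
        obstruction σ ξ A φ ⟨frame σ ξ k * frame σ ξ l,
          mul_mem_approx σ (frame_mem_approx σ k) (frame_mem_approx σ l)⟩ := by
  simp [obstructionCochain_apply, entry_frameBasis]

theorem obstructionCochain_frame (i j : Fin d) :
    obstructionCochain σ ξ φ hA ![frameBasis σ A hA i, frameBasis σ A hA j] =
        obstruction σ ξ A φ ⟨frame σ ξ i * frame σ ξ j,
          mul_mem_approx σ (frame_mem_approx σ i) (frame_mem_approx σ j)⟩ := by
  simp [obstructionCochain_frame_right, entry_frameBasis]

theorem frameBasis_eq (l : Fin d) : frameBasis σ A hA l =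
    ⟨_, mapMatrix_mem_of_mem_approx σ ξ hA (frame_mem_approx σ l)⟩ := by
  apply Subtype.ext
  exact (coe_frameBasis σ A hA l).trans (map_frame σ _ ξ l).symm

/-- The structure constants of `A` are the reductions of the free entries of products upstairs,
which matches the sums in the two product formulas with values of the cochain. -/
theorem entry_frameBasis_mul (i j l : Fin d) :
    entry σ ((frameBasis σ A hA i * frameBasis σ A hA j : A) : Matrix (Fin n) (Fin n) K) (.inl l) =
      algebraMap P K (entry σ (frame σ ξ i * frame σ ξ j) (.inl l)) := by
  rw [frameBasis_eq, frameBasis_eq]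
  change entry σ ((algebraMap P K).mapMatrix _ * (algebraMap P K).mapMatrix _) _ = _
  rw [← map_mul]
  rfl

/-- The cocycle identity is associativity upstairs: `(b₀ b₁) b₂` expanded on the left and `b₀ (b₁
b₂)` expanded on the right have the same obstruction. By multilinearity, frame vectors suffice. -/
theorem d_obstructionCochain : HochschildCochain.d K A
    (Matrix (Fin n) (Fin n) K ⧸ Subalgebra.toSubmodule A) 2 (obstructionCochain σ ξ φ hA) = 0 := by
  refine Module.Basis.ext_multilinear (fun _ => frameBasis σ A hA) fun v => ?_
  have hv : (fun i => frameBasis σ A hA (v i)) =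
      ![frameBasis σ A hA (v 0), frameBasis σ A hA (v 1), frameBasis σ A hA (v 2)] := by
    ext i; fin_cases i <;> rfl
  rw [hv, HochschildCochain.d_two_apply, obstructionCochain_frame, obstructionCochain_frame,
    obstructionCochain_frame_left, obstructionCochain_frame_right]
  have h1 := obstruction_mul_right σ ξ φ hA
    (mul_mem_approx σ (frame_mem_approx σ (v 0)) (frame_mem_approx σ (v 1)))
    (frame_mem_approx σ (v 2))
  have h2 := obstruction_mul_left σ ξ φ hA (frame_mem_approx σ (v 0))
    (mul_mem_approx σ (frame_mem_approx σ (v 1)) (frame_mem_approx σ (v 2)))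
  rw [← frameBasis_eq σ ξ hA] at h1 h2
  have h3 := h1.symm.trans ((congrArg _ (Subtype.ext (mul_assoc _ _ _))).trans h2)
  simp only [entry_frameBasis_mul, algebraMap_smul] at h3 ⊢
  rw [zero_apply, sub_add_eq_add_sub, sub_sub, sub_eq_zero, h3,
    add_comm]

include hA in
/-- If all second Hochschild cocycles of the fibre are coboundaries, a functional on `moldIdeal`
extends to a derivation of the ambient ring, provided the coordinates `ξ` are independent
variables. -/
theorem exists_derivation_eq {R : Type*} [CommRing R] [Algebra R P] [Algebra R K]
    [IsScalarTower R P K]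
    (hH : Subsingleton (HochschildCohomology K A
      (Matrix (Fin n) (Fin n) K ⧸ Subalgebra.toSubmodule A) 2))
    (hD : ∀ γ : Matrix (Fin e) (Fin d) K, ∃ D : Derivation R P K, ∀ c l, D (ξ c l) = γ c l) :
    ∃ D : Derivation R P K, ∀ r : moldIdeal σ ξ, D r = φ r := by
  obtain ⟨g, hg⟩ := HochschildCochain.exists_d_eq_of_subsingleton 1 hH _
    (d_obstructionCochain σ ξ φ hA)
  choose w hw using fun l => Submodule.Quotient.mk_surjective _ (g ![frameBasis σ A hA l])
  -- Column `l` of `γ` holds the coordinates of `g(bₗ)` in `M_n(K)/A`; the derivation is to displace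
  -- the frame in these directions.
  let γ : Matrix (Fin e) (Fin d) K :=
    Matrix.of fun c l => defect σ (ξ.map (algebraMap P K)) (w l) c
  obtain ⟨D, hDγ⟩ := hD γ
  refine ⟨D, ?_⟩
  -- `D` is `P`-linear on the ideal: the Leibniz term `r • D p` vanishes because `r` is zero in `K`.
  let ψ : moldIdeal σ ξ →ₗ[P] K :=
    { toFun := fun r => φ r - D r
      map_add' := fun r s => by simp; ring
      map_smul' := fun p r => by
        have h0 := algebraMap_eq_zero_of_mem σ ξ hA r.2
        simp [Algebra.smul_def, h0, mul_sub] }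
  have hgγ (l : Fin d) : g ![frameBasis σ A hA l] =
      ∑ c, γ c l • Submodule.Quotient.mk (unitMat σ K (.inr c)) := by
    rw [← hw, mk_eq_sum_defect σ A hA]
    rfl
  have hglin (a : A) : g ![a] =
      ∑ l, entry σ (a : Matrix (Fin n) (Fin n) K) (.inl l) • g ![frameBasis σ A hA l] := by
    have hG (x : A) : g.toLinearMap ![0] 0 x = g ![x] := by
      rw [MultilinearMap.toLinearMap_apply]
      congr 1
      ext i; fin_cases i; simp
    simp only [← hG]
    conv_lhs => rw [← (frameBasis σ A hA).sum_repr a]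
    simp only [map_sum, map_smul, frameBasis_repr]
  -- Differentiating the equations varies both the matrix and `ξ`. The variation of `ξ` contributes
  -- the terms in `γ`, which become values of `g` in `hDsum`.
  have hDdef (m : Matrix (Fin n) (Fin n) P) (c : Fin e) :
      D (defect σ ξ m c) = defect σ (ξ.map (algebraMap P K)) (m.map D) c -
        ∑ l, algebraMap P K (entry σ m (.inl l)) * γ c l := by
    simp only [defect_apply, entry, map_sub, map_sum, Derivation.leibniz, Algebra.smul_def,
      Matrix.map_apply, Finset.sum_add_distrib, hDγ]
    ring
  have hDsum (m : Matrix (Fin n) (Fin n) P) :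
      ∑ c, D (defect σ ξ m c) • Submodule.Quotient.mk (unitMat σ K (.inr c)) =
        (Submodule.Quotient.mk (m.map D) :
          Matrix (Fin n) (Fin n) K ⧸ Subalgebra.toSubmodule A) -
        ∑ l, algebraMap P K (entry σ m (.inl l)) • g ![frameBasis σ A hA l] := by
    simp only [mk_eq_sum_defect σ A hA (m.map D), hDdef, sub_smul, Finset.sum_sub_distrib,
      Finset.sum_smul, hgγ, Finset.smul_sum, smul_smul]
    rw [Finset.sum_comm (s := Finset.univ (α := Fin d))]
  -- The free entries of a frame vector are constants, so only its dependent entries, a column of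
  -- `ξ`, have a derivative.
  have hDframe (i : Fin d) : Submodule.Quotient.mk ((frame σ ξ i).map D) =
      g ![frameBasis σ A hA i] := by
    rw [mk_eq_sum_defect σ A hA, hgγ]
    refine Finset.sum_congr rfl fun c _ => ?_
    congr 1
    have h1 (l : Fin d) : entry σ ((frame σ ξ i).map D) (.inl l) = 0 := by
      change D (entry σ (frame σ ξ i) (.inl l)) = 0
      rw [entry_frame_inl]
      split_ifs <;> simp
    have h2 : entry σ ((frame σ ξ i).map D) (.inr c) = γ c i := by
      change D (entry σ (frame σ ξ i) (.inr c)) = _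
      rw [entry_frame_inr, hDγ]
    rw [defect_apply, h2]
    simp only [h1, mul_zero, Finset.sum_const_zero, sub_zero]
  have hDmul (m m' : Matrix (Fin n) (Fin n) P) : (m * m').map D =
      (algebraMap P K).mapMatrix m * m'.map D + m.map D * (algebraMap P K).mapMatrix m' := by
    ext i j
    simp [Matrix.mul_apply, Derivation.leibniz, Algebra.smul_def, Finset.sum_add_distrib, mul_comm]
  -- Applied to the defect of `bᵢ bⱼ`, the derivation gives `bᵢ g(bⱼ) - g(bᵢ bⱼ) + g(bᵢ) bⱼ`, which
  -- is `(d g)(bᵢ, bⱼ)`, the value given by `φ`.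
  have hψ (i j : Fin d) : obstruction σ ξ A ψ ⟨frame σ ξ i * frame σ ξ j,
      mul_mem_approx σ (frame_mem_approx σ i) (frame_mem_approx σ j)⟩ = 0 := by
    have h1 := congrArg (fun f => f ![frameBasis σ A hA i, frameBasis σ A hA j]) hg
    simp only [HochschildCochain.d_one_apply] at h1
    rw [obstructionCochain_frame] at h1
    have h2 := hDsum (frame σ ξ i * frame σ ξ j)
    simp only [← entry_frameBasis_mul σ ξ hA] at h2
    rw [← hglin, hDmul, Submodule.Quotient.mk_add] at h2
    have h3 : (Submodule.Quotient.mk ((algebraMap P K).mapMatrix (frame σ ξ i) *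
        (frame σ ξ j).map D) : Matrix (Fin n) (Fin n) K ⧸ Subalgebra.toSubmodule A) =
        frameBasis σ A hA i • g ![frameBasis σ A hA j] := by
      rw [← hDframe, frameBasis_eq]
      rfl
    have h4 : (Submodule.Quotient.mk ((frame σ ξ i).map D *
        (algebraMap P K).mapMatrix (frame σ ξ j)) :
          Matrix (Fin n) (Fin n) K ⧸ Subalgebra.toSubmodule A) =
        MulOpposite.op (frameBasis σ A hA j) • g ![frameBasis σ A hA i] := by
      rw [← hDframe, frameBasis_eq]
      rfl
    rw [h3, h4, add_sub_right_comm, h1, obstruction_apply] at h2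
    rw [obstruction_apply]
    change ∑ c, (φ _ - D (defect σ ξ (frame σ ξ i * frame σ ξ j) c)) • _ = _
    simp only [sub_smul, Finset.sum_sub_distrib]
    rw [h2, sub_self]
  -- The unit equations come for free: expanding `1 * bₖ`, whose obstruction is that of `bₖ` and so
  -- zero, shows that the obstruction of `1` is killed by right multiplication by every `bₖ`, hence
  -- by `1 ∈ A`.
  have hone : obstruction σ ξ A ψ ⟨1, one_mem_approx σ⟩ = 0 := by
    have h1 (k : Fin d) : MulOpposite.op (frameBasis σ A hA k) •
        obstruction σ ξ A ψ ⟨1, one_mem_approx σ⟩ = 0 := by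
      have h2 := obstruction_mul_right σ ξ ψ hA (one_mem_approx σ) (frame_mem_approx σ k)
      simp only [hψ, smul_zero, Finset.sum_const_zero, zero_add, ← frameBasis_eq σ ξ hA] at h2
      rw [← h2, ← obstruction_frame σ ξ A ψ k]
      congr 1
      exact Subtype.ext (one_mul _)
    rw [← one_smul Aᵐᵒᵖ (obstruction σ ξ A ψ ⟨1, one_mem_approx σ⟩), ← MulOpposite.op_one,
      ← (frameBasis σ A hA).sum_repr 1, Finset.op_sum, Finset.sum_smul]
    simp only [MulOpposite.op_smul, smul_assoc, h1, smul_zero, Finset.sum_const_zero]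
  have hker (r : P) (hr : r ∈ moldIdeal σ ξ) : ψ ⟨r, hr⟩ = 0 := by
    -- The vanishing obstructions are combinations of independent classes with coefficients the
    -- values of `ψ` on the generators of the ideal.
    have h1 : moldIdeal σ ξ ≤ (LinearMap.ker ψ).map (moldIdeal σ ξ).subtype := by
      rw [moldIdeal_le_iff]
      rw [obstruction_apply] at hone
      simp only [obstruction_apply] at hψ
      exact ⟨fun c => ⟨_, congrFun (eq_zero_of_sum_smul_mk σ A hA hone) c, rfl⟩,
        fun i j c => ⟨_, congrFun (eq_zero_of_sum_smul_mk σ A hA (hψ i j)) c, rfl⟩⟩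
    obtain ⟨r', hr', rfl⟩ := h1 hr
    exact hr'
  exact fun r => (sub_eq_zero.1 (hker r r.2)).symm

end Obstruction

end

end MoldChart

/-! ### The Jacobian criterion and smoothness of the chart rings. -/

namespace MoldChart

noncomputable section

open TensorProduct KaehlerDifferential

/-- A derivation on `Q` extends to any formally étale `Q`-algebra. -/
theorem exists_derivation_extend (R : Type*) {Q P K : Type*} [CommRing R] [CommRing Q] [CommRing P]
    [CommRing K] [Algebra R Q] [Algebra R P] [Algebra Q P] [IsScalarTower R Q P] [Algebra R K]
    [Algebra P K] [Algebra Q K] [IsScalarTower Q P K] [IsScalarTower R P K] [IsScalarTower R Q K]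
    [Algebra.FormallyEtale Q P] (D₀ : Derivation R Q K) :
    ∃ D : Derivation R P K, ∀ q, D (algebraMap Q P q) = D₀ q := by
  -- Formal étaleness identifies `Ω[P⁄R]` with this base change, to which the linear form of `D₀`
  -- extends.
  let ℓ : P ⊗[Q] Ω[Q⁄R] →ₗ[P] K :=
    TensorProduct.AlgebraTensorModule.lift
      ((LinearMap.lsmul P (Ω[Q⁄R] →ₗ[Q] K)).flip D₀.liftKaehlerDifferential)
  refine ⟨(ℓ ∘ₗ (tensorKaehlerEquivOfFormallyEtale R Q P).symm.toLinearMap).compDer (D R P),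
    fun q => ?_⟩
  have h : (tensorKaehlerEquivOfFormallyEtale R Q P).symm (D R P (algebraMap Q P q)) =
      1 ⊗ₜ D R Q q := by
    rw [LinearEquiv.symm_apply_eq]
    simp
  change ℓ ((tensorKaehlerEquivOfFormallyEtale R Q P).symm (D R P (algebraMap Q P q))) = _
  rw [h]
  simp [ℓ]

/-- The Jacobian criterion, in terms of derivations: a local algebra `S = P/I` is formally smooth if
every functional on `I` with values in a residue field extends to a derivation of `P`. -/
theorem formallySmooth_of_exists_derivation {R S : Type*} (P K : Type*) [CommRing R] [CommRing S]
    [IsLocalRing S] [Algebra R S] [Field K] [CommRing P] [Algebra R P] [Algebra P S]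
    [IsScalarTower R P S] [Algebra S K] [Algebra P K] [IsScalarTower P S K] [Algebra R K]
    [IsScalarTower R P K]
    [Algebra.FormallySmooth R P] [Module.Free P Ω[P⁄R]] [Module.Finite P Ω[P⁄R]]
    (h₁ : Function.Surjective (algebraMap P S)) (h₂ : (RingHom.ker (algebraMap P S)).FG)
    (h₃ : IsLocalRing.maximalIdeal S ≤ RingHom.ker (algebraMap S K))
    (h : ∀ φ : RingHom.ker (algebraMap P S) →ₗ[P] K, ∃ D : Derivation R P K, ∀ r, D r.1 = φ r) :
    Algebra.FormallySmooth R S := by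
  rw [Algebra.FormallySmooth.iff_injective_cotangentComplexBaseChange P K h₁ h₂ h₃,
    injective_iff_map_eq_zero]
  intro v hv
  -- Injectivity over a field is tested on functionals: the derivation extending `ℓ` makes `ℓ`
  -- factor through `cotangentComplexBaseChange`, so `ℓ` kills the kernel.
  rw [← Module.forall_dual_apply_eq_zero_iff K]
  intro ℓ
  obtain ⟨D, hD⟩ := h ((ℓ.restrictScalars P).comp (TensorProduct.mk P K _ 1))
  have hcomp : ℓ = (LinearMap.liftBaseChange K D.liftKaehlerDifferential) ∘ₗ
      cotangentComplexBaseChange R S P K := by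
    ext r
    have h1 := hD r
    simp [cotangentComplexBaseChange_tmul, kerToTensor_apply, h1]
  rw [hcomp, LinearMap.comp_apply, hv, map_zero]

variable {n d e : ℕ} (σ : Fin d ⊕ Fin e ≃ Fin n × Fin n)

/-- The matrix of independent variables. -/
def varMatrix (R : Type*) [CommRing R] (d e : ℕ) :
    Matrix (Fin e) (Fin d) (MvPolynomial (Fin e × Fin d) R) :=
  Matrix.of fun c l => MvPolynomial.X (c, l)

/-- The coordinate ring of the chart of molds attached to `σ`. -/
abbrev ChartRing (R : Type*) [CommRing R] : Type _ :=
  MvPolynomial (Fin e × Fin d) R ⧸ moldIdeal σ (varMatrix R d e)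

/-- The universal coordinates. -/
def chartCoord (R : Type*) [CommRing R] : Matrix (Fin e) (Fin d) (ChartRing σ R) :=
  (varMatrix R d e).map (Ideal.Quotient.mk _)

theorem isMold_chartCoord (R : Type*) [CommRing R] : IsMold σ (chartCoord σ R) :=
  (isMold_map_iff σ _ _).2 Ideal.mk_ker.ge

instance (R : Type*) [CommRing R] : Algebra.FinitePresentation R (ChartRing σ R) :=
  Algebra.FinitePresentation.quotient (moldIdeal_fg σ _)

/-- `ULift ℤ` places the base in the universe of the schemes. Like `ℤ`, it has only one homomorphism
to any ring, so only the images of the variables matter. -/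
theorem chartRing_hom_ext {T : Type*} [CommRing T] {f g : ChartRing σ (ULift.{u} ℤ) →+* T}
    (h : (chartCoord σ (ULift.{u} ℤ)).map f = (chartCoord σ (ULift.{u} ℤ)).map g) : f = g := by
  apply Ideal.Quotient.ringHom_ext
  apply MvPolynomial.ringHom_ext
  · intro r
    exact RingHom.congr_fun ((RingHom.cancel_right (f := (ULift.ringEquiv.{0, u} (R := ℤ)).symm.toRingHom)
      (ULift.ringEquiv.{0, u} (R := ℤ)).symm.surjective).1 (Subsingleton.elim
      (((f.comp (Ideal.Quotient.mk _)).comp MvPolynomial.C).comp _)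
      (((g.comp (Ideal.Quotient.mk _)).comp MvPolynomial.C).comp _))) r
  · rintro ⟨c, l⟩
    exact congrFun (congrFun h c) l

/-- The homomorphism from the coordinate ring of a chart with prescribed coordinates. -/
theorem exists_chartRing_hom {T : Type*} [CommRing T] {ξ : Matrix (Fin e) (Fin d) T}
    (h : IsMold σ ξ) :
    ∃ f : ChartRing σ (ULift.{u} ℤ) →+* T, (chartCoord σ (ULift.{u} ℤ)).map f = ξ := by
  let g : MvPolynomial (Fin e × Fin d) (ULift.{u} ℤ) →+* T :=
    MvPolynomial.eval₂Hom ((Int.castRingHom T).comp (ULift.ringEquiv.{0, u} (R := ℤ)).toRingHom)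
      fun p => ξ p.1 p.2
  have hg : (varMatrix (ULift.{u} ℤ) d e).map g = ξ := by
    ext c l
    simp [varMatrix, g]
  have hI : ∀ a ∈ moldIdeal σ (varMatrix (ULift.{u} ℤ) d e), g a = 0 := fun a ha =>
    (isMold_map_iff σ _ _).1 (hg.symm ▸ h) ha
  refine ⟨Ideal.Quotient.lift _ g hI, ?_⟩
  ext c l
  exact (Ideal.Quotient.lift_mk _ g hI).trans (congrFun (congrFun hg c) l)

/-- The local ring `S` of the chart is a quotient of the local ring `P` of affine space by the ideal
of the mold equations, so the Jacobian criterion applies and `exists_derivation_eq` supplies the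
derivations. -/
theorem isSmoothAt_chartRing {R : Type*} [CommRing R] {K : Type*} [Field K]
    (f : ChartRing σ R →+* K) (A : Subalgebra K (Matrix (Fin n) (Fin n) K))
    (hA : ∀ m, m ∈ A ↔ defect σ ((chartCoord σ R).map f) m = 0)
    (hH : Subsingleton (HochschildCohomology K A
      (Matrix (Fin n) (Fin n) K ⧸ Subalgebra.toSubmodule A) 2))
    [(RingHom.ker f).IsPrime] :
    Algebra.IsSmoothAt R (RingHom.ker f) := by
  let p := RingHom.ker f
  let S := Localization.AtPrime p
  let Q := MvPolynomial (Fin e × Fin d) R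
  let f₀ : Q →ₐ[R] ChartRing σ R := Ideal.Quotient.mkₐ R _
  have hf₀ : Function.Surjective f₀ := Ideal.Quotient.mk_surjective
  let M := p.primeCompl
  let M' := M.comap f₀
  let P := Localization M'
  let fP : P →ₐ[R] S := IsLocalization.liftAlgHom (M := M')
      (f := (IsScalarTower.toAlgHom R (ChartRing σ R) S).comp f₀) fun x ↦ by
    simpa using IsLocalization.map_units (M := M) S ⟨f₀ x.1, x.2⟩
  have hf₁ : Function.Surjective fP := by
    intro x
    obtain ⟨x, ⟨s, hs⟩, rfl⟩ := IsLocalization.exists_mk'_eq M x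
    obtain ⟨x, rfl⟩ := hf₀ x
    obtain ⟨s, rfl⟩ := hf₀ s
    refine ⟨IsLocalization.mk' (M := M') _ x ⟨s, hs⟩, ?_⟩
    simp [fP, IsLocalization.lift_mk', Units.mul_inv_eq_iff_eq_mul, IsUnit.liftRight]
  let ξ : Matrix (Fin e) (Fin d) P := (varMatrix R d e).map (algebraMap Q P)
  -- A fraction that dies in `S` has a numerator killed by some element of `M`; a lift of that
  -- element to `Q` lies in `M'` and multiplies the numerator into `moldIdeal`.
  have hker : RingHom.ker fP = moldIdeal σ ξ := by
    rw [← map_moldIdeal]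
    refine le_antisymm ?_ (Ideal.map_le_iff_le_comap.mpr fun x hx ↦ ?_)
    · intro x hx
      obtain ⟨x, s, rfl⟩ := IsLocalization.exists_mk'_eq M' x
      obtain ⟨a, ha, e⟩ : ∃ a ∈ M, a * f₀ x = 0 := by
        simpa [fP, IsLocalization.lift_mk', IsLocalization.map_eq_zero_iff M] using hx
      obtain ⟨a, rfl⟩ := hf₀ a
      rw [IsLocalization.mk'_mem_map_algebraMap_iff]
      refine ⟨a, ha, ?_⟩
      rw [← map_mul] at e
      exact Ideal.Quotient.eq_zero_iff_mem.1 e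
    · have h0 : f₀ x = 0 := Ideal.Quotient.eq_zero_iff_mem.2 hx
      simp [fP, h0]
  let fS : S →+* K := IsLocalization.lift (M := M) (g := f) fun y => by
    exact IsUnit.mk0 _ y.2
  let aR : Algebra R K := (f.comp (algebraMap R (ChartRing σ R))).toAlgebra
  let aQ : Algebra Q K := (f.comp f₀.toRingHom).toAlgebra
  let aS : Algebra S K := fS.toAlgebra
  let aPS : Algebra P S := fP.toRingHom.toAlgebra
  let aP : Algebra P K := (fS.comp fP.toRingHom).toAlgebra
  have : IsScalarTower R P S := .of_algebraMap_eq' fP.comp_algebraMap.symm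
  have : IsScalarTower P S K := .of_algebraMap_eq' rfl
  have hfS (x : ChartRing σ R) : fS (algebraMap _ S x) = f x := by simp [fS]
  have : @IsScalarTower Q P K Algebra.toSMul Algebra.toSMul Algebra.toSMul :=
      .of_algebraMap_eq fun q => by
    change f (f₀ q) = fS (fP (algebraMap Q P q))
    rw [← hfS]
    simp [fP]
  have : IsScalarTower R Q K := .of_algebraMap_eq fun r => by
    change f _ = f (f₀ _)
    rw [AlgHom.commutes]
  have : IsScalarTower R P K := .to₁₃₄ R Q P K
  have : Algebra.FormallyEtale Q P := .of_isLocalization M'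
  have : Algebra.FormallySmooth R P := .comp _ Q _
  have : Module.Free P Ω[P⁄R] :=
    .of_equiv (tensorKaehlerEquivOfFormallyEtale R Q P)
  have : Module.Finite P Ω[P⁄R] :=
    .equiv (tensorKaehlerEquivOfFormallyEtale R Q P)
  have hker' : RingHom.ker (algebraMap P S) = moldIdeal σ ξ := hker
  refine formallySmooth_of_exists_derivation P K (S := S) hf₁ (hker' ▸ moldIdeal_fg σ ξ) ?_ ?_
  · rw [← Localization.AtPrime.map_eq_maximalIdeal, Ideal.map_le_iff_le_comap]
    intro x hx
    change fS (algebraMap _ S x) = 0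
    rw [hfS]
    exact hx
  · rw [hker']
    intro φ
    refine exists_derivation_eq σ ξ φ (A := A) ?_ hH fun γ => ?_
    · have : ξ.map (algebraMap P K) = (chartCoord σ R).map f := by
        ext c l
        change algebraMap P K (algebraMap Q P (varMatrix R d e c l)) = _
        rw [← IsScalarTower.algebraMap_apply]
        rfl
      rwa [this]
    -- On polynomials a derivation takes arbitrary values on the variables; it extends to the
    -- localisation `P`.
    · obtain ⟨D, hD⟩ := exists_derivation_extend R (P := P)
        (MvPolynomial.mkDerivation (A := K) R fun x : Fin e × Fin d => γ x.1 x.2)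
      refine ⟨D, fun c l => ?_⟩
      exact (hD _).trans (MvPolynomial.mkDerivation_X _ _ _)

end

end MoldChart

/-! ### Local coordinates of molds on schemes. -/

noncomputable section

namespace AlgebraicGeometry

open MoldChart

variable {n d e : ℕ} {X Y Z : Scheme.{u}} {σ : Fin d ⊕ Fin e ≃ Fin n × Fin n}

/-- Restriction of coordinates. -/
abbrev coordRes (X : Scheme.{u}) {U V : X.Opens} (h : V ≤ U) (ξ : Matrix (Fin e) (Fin d) Γ(X, U)) :
    Matrix (Fin e) (Fin d) Γ(X, V) :=
  ξ.map (X.presheaf.map (homOfLE h).op).hom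

theorem coordRes_coordRes {U V W : X.Opens} (h : V ≤ U) (h' : W ≤ V)
    (ξ : Matrix (Fin e) (Fin d) Γ(X, U)) :
    coordRes X h' (coordRes X h ξ) = coordRes X (h'.trans h) ξ := by
  ext i j
  simp only [Matrix.map_apply]
  rw [← CommRingCat.comp_apply, ← Functor.map_comp]
  rfl

theorem coordRes_self {U : X.Opens} (h : U ≤ U) (ξ : Matrix (Fin e) (Fin d) Γ(X, U)) :
    coordRes X h ξ = ξ := by
  ext i j
  exact ConcreteCategory.congr_hom (X.presheaf.map_id (op U)) _

theorem defect_res_eq_zero {U V : X.Opens} (h : V ≤ U) {ξ : Matrix (Fin e) (Fin d) Γ(X, U)}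
    {m : Matrix (Fin n) (Fin n) Γ(X, U)} (hm : defect σ ξ m = 0) :
    defect σ (coordRes X h ξ) (matrixRes X n h m) = 0 :=
  defect_map_eq_zero σ _ hm

theorem defect_eq_zero_of_locally {U : X.Opens} {ξ : Matrix (Fin e) (Fin d) Γ(X, U)}
    {m : Matrix (Fin n) (Fin n) Γ(X, U)}
    (h : ∀ x ∈ U, ∃ (V : X.Opens) (h : V ≤ U), x ∈ V ∧
      defect σ (coordRes X h ξ) (matrixRes X n h m) = 0) :
    defect σ ξ m = 0 := by
  ext c
  refine eq_zero_of_locally_eq_zero _ fun x hx => ?_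
  obtain ⟨V, hV, hxV, hd⟩ := h x hx
  exact ⟨V, hV, hxV, (map_defect σ _ ξ m c).trans (congrFun hd c)⟩

namespace Mold

/-- `ξ` are coordinates on `U` of the mold `A` in the chart attached to `σ`. -/
def HasCoords (A : Mold n d X) (σ : Fin d ⊕ Fin e ≃ Fin n × Fin n) (U : X.Opens)
    (ξ : Matrix (Fin e) (Fin d) Γ(X, U)) : Prop :=
  ∀ (V : X.Opens) (h : V ≤ U) (m : Matrix (Fin n) (Fin n) Γ(X, V)),
    m ∈ A.sections V ↔ defect σ (coordRes X h ξ) m = 0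

theorem HasCoords.mem_iff {A : Mold n d X} {U : X.Opens} {ξ : Matrix (Fin e) (Fin d) Γ(X, U)}
    (h : A.HasCoords σ U ξ) (m : Matrix (Fin n) (Fin n) Γ(X, U)) :
    m ∈ A.sections U ↔ defect σ ξ m = 0 := by
  rw [h U le_rfl, coordRes_self]

theorem HasCoords.res {A : Mold n d X} {U V : X.Opens} {ξ : Matrix (Fin e) (Fin d) Γ(X, U)}
    (h : A.HasCoords σ U ξ) (hV : V ≤ U) : A.HasCoords σ V (coordRes X hV ξ) := by
  intro W hW m
  rw [h W (hW.trans hV), coordRes_coordRes]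

theorem HasCoords.isMold {A : Mold n d X} {U : X.Opens} {ξ : Matrix (Fin e) (Fin d) Γ(X, U)}
    (h : A.HasCoords σ U ξ) : IsMold σ ξ :=
  isMold_of_mem_iff (A.sections U) h.mem_iff

theorem HasCoords.unique {A : Mold n d X} {U : X.Opens} {ξ η : Matrix (Fin e) (Fin d) Γ(X, U)}
    (h : A.HasCoords σ U ξ) (h' : A.HasCoords σ U η) : ξ = η :=
  coord_eq_of_defect_eq_zero fun m hm => (h'.mem_iff m).1 ((h.mem_iff m).2 hm)

theorem hasCoords_of_locally {A : Mold n d X} {U : X.Opens} {ξ : Matrix (Fin e) (Fin d) Γ(X, U)}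
    (h : ∀ x ∈ U, ∃ (V : X.Opens) (h : V ≤ U), x ∈ V ∧ A.HasCoords σ V (coordRes X h ξ)) :
    A.HasCoords σ U ξ := by
  intro V hV m
  constructor
  · intro hm
    refine defect_eq_zero_of_locally fun x hx => ?_
    obtain ⟨W, hW, hxW, hc⟩ := h x (hV hx)
    refine ⟨V ⊓ W, inf_le_left, ⟨hx, hxW⟩, ?_⟩
    have := (hc (V ⊓ W) inf_le_right _).1 (A.res_mem inf_le_left hm)
    rw [coordRes_coordRes] at this ⊢
    exact this
  · intro hm
    refine A.mem_of_locally_mem m fun x hx => ?_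
    obtain ⟨W, hW, hxW, hc⟩ := h x (hV hx)
    refine ⟨V ⊓ W, inf_le_left, ⟨hx, hxW⟩, (hc (V ⊓ W) inf_le_right _).2 ?_⟩
    have := defect_res_eq_zero (inf_le_left : V ⊓ W ≤ V) hm
    rw [coordRes_coordRes] at this ⊢
    exact this

/-- Molds with the same coordinates on a neighbourhood of each point agree. -/
theorem ext_of_hasCoords {A B : Mold n d X}
    (h : ∀ x, ∃ (U : X.Opens) (e : ℕ) (σ : Fin d ⊕ Fin e ≃ Fin n × Fin n)
      (ξ : Matrix (Fin e) (Fin d) Γ(X, U)), x ∈ U ∧ A.HasCoords σ U ξ ∧ B.HasCoords σ U ξ) :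
    A = B := by
  ext V m
  constructor
  all_goals
    intro hm
    refine Mold.mem_of_locally_mem _ m fun x hx => ?_
    obtain ⟨U, e, σ, ξ, hxU, hA, hB⟩ := h x
    refine ⟨V ⊓ U, inf_le_left, ⟨hx, hxU⟩, ?_⟩
  · exact (hB _ inf_le_right _).2 ((hA _ inf_le_right _).1 (A.res_mem _ hm))
  · exact (hA _ inf_le_right _).2 ((hB _ inf_le_right _).1 (B.res_mem _ hm))

/-- A mold with a basis on `U` has coordinates where a maximal minor of the basis is invertible. -/
theorem exists_hasCoords_basicOpen (A : Mold n d X) (σ : Fin d ⊕ Fin e ≃ Fin n × Fin n)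
    {U : X.Opens} (t : Fin d → Matrix (Fin n) (Fin n) Γ(X, U))
    (ht : ∀ (V : X.Opens) (h : V ≤ U),
      Submodule.span Γ(X, V) (Set.range fun i => matrixRes X n h (t i)) =
        Subalgebra.toSubmodule (A.sections V)) :
    ∃ ξ, A.HasCoords σ (X.basicOpen (Matrix.of fun i l => entry σ (t i) (.inl l)).det) ξ := by
  let q : Matrix (Fin d) (Fin d) Γ(X, U) := Matrix.of fun i l => entry σ (t i) (.inl l)
  let W := X.basicOpen q.det
  have hWU : W ≤ U := X.basicOpen_le _
  let r := (X.presheaf.map (homOfLE hWU).op).hom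
  let qW : Matrix (Fin d) (Fin d) Γ(X, W) := r.mapMatrix q
  have hqW : IsUnit qW.det := by
    rw [← RingHom.map_det]
    exact RingedSpace.isUnit_res_basicOpen _ q.det
  -- Multiplication by the inverse of the minor turns the free entries of the basis into the
  -- identity matrix, so the new basis is the frame of its own dependent entries `ξ`.
  let b (l : Fin d) : Matrix (Fin n) (Fin n) Γ(X, W) :=
    ∑ i, qW⁻¹ l i • matrixRes X n hWU (t i)
  let ξ : Matrix (Fin e) (Fin d) Γ(X, W) := Matrix.of fun c l => entry σ (b l) (.inr c)
  have hbl (l k : Fin d) : entry σ (b l) (.inl k) = if l = k then 1 else 0 := by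
    have h1 : (qW⁻¹ * qW) l k = if l = k then 1 else 0 := by
      rw [Matrix.nonsing_inv_mul _ hqW, Matrix.one_apply]
    rw [← h1, Matrix.mul_apply, entry_sum]
    rfl
  have hb : b = frame σ ξ := by
    funext l
    refine ext_entry σ fun k => ?_
    rcases k with k | c
    · rw [entry_frame_inl, hbl]
    · rw [entry_frame_inr]
      rfl
  have hbA (l : Fin d) : b l ∈ A.sections W := by
    rw [← Subalgebra.mem_toSubmodule, ← ht W hWU]
    exact Submodule.sum_mem _ fun i _ => Submodule.smul_mem _ _ (Submodule.subset_span ⟨i, rfl⟩)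
  have htb (i : Fin d) : matrixRes X n hWU (t i) = ∑ l, qW i l • b l := by
    have h1 (k : Fin d) : (qW * qW⁻¹) i k = if i = k then 1 else 0 := by
      rw [Matrix.mul_nonsing_inv _ hqW, Matrix.one_apply]
    simp only [b, Finset.smul_sum, smul_smul]
    rw [Finset.sum_comm]
    simp only [← Finset.sum_smul, ← Matrix.mul_apply, h1]
    simp
  refine ⟨ξ, fun V hV m => ⟨fun hm => ?_, fun hm => ?_⟩⟩
  · rw [← Subalgebra.mem_toSubmodule, ← ht V (hV.trans hWU)] at hm
    have h1 : Submodule.span Γ(X, V)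
        (Set.range fun i => matrixRes X n (hV.trans hWU) (t i)) ≤
        LinearMap.ker (defect σ (coordRes X hV ξ)) := by
      rw [Submodule.span_le]
      rintro _ ⟨i, rfl⟩
      simp only [SetLike.mem_coe, LinearMap.mem_ker]
      rw [← matrixRes_matrixRes hWU hV, htb, hb]
      exact defect_res_eq_zero hV (defect_sum_smul_frame σ ξ _)
    exact h1 hm
  · rw [eq_sum_frame σ hm]
    refine sum_mem fun l _ => Subalgebra.smul_mem _ ?_ _
    rw [← map_frame, ← hb]
    exact A.res_mem hV (hbA l)

/-- Every mold has coordinates locally. -/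
theorem exists_hasCoords (A : Mold n d X) (x : X) :
    ∃ (U : X.Opens) (e : ℕ) (σ : Fin d ⊕ Fin e ≃ Fin n × Fin n)
      (ξ : Matrix (Fin e) (Fin d) Γ(X, U)), x ∈ U ∧ A.HasCoords σ U ξ := by
  obtain ⟨U, hxU, e', t, ht⟩ := A.exists_basis x
  -- Linear independence alone need not survive evaluation at `x`, but a full basis of `M_n` does.
  -- This is where local freeness of the quotient is needed.
  obtain ⟨t', ht'⟩ := exists_basis_mapMatrix (X.evaluation U x hxU).hom t
  obtain ⟨e, σ, hσ⟩ := exists_det_ne_zero (fun i => t' (Sum.inl i))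
    (t'.linearIndependent.comp _ Sum.inl_injective)
  let q : Matrix (Fin d) (Fin d) Γ(X, U) :=
    Matrix.of fun i l => entry σ (t (Sum.inl i)) (.inl l)
  have hq : (X.evaluation U x hxU).hom q.det ≠ 0 := by
    have hqm : (X.evaluation U x hxU).hom.mapMatrix q =
        Matrix.of fun i l => entry σ (t' (Sum.inl i)) (.inl l) := by
      ext i l
      simp [q, ht', entry]
    rw [RingHom.map_det, hqm]
    exact hσ
  have hxW : x ∈ X.basicOpen q.det := by
    rw [← Scheme.evaluation_ne_zero_iff_mem_basicOpen _ x hxU]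
    exact hq
  obtain ⟨ξ, hξ⟩ := A.exists_hasCoords_basicOpen σ (fun i => t (Sum.inl i)) ht
  exact ⟨_, e, σ, ξ, hxW, hξ⟩

end Mold

/-- A subsheaf of algebras of `M_n(𝒪_X)` which is locally given by coordinates is a mold. -/
def Mold.ofCoords (sections : ∀ U : X.Opens, Subalgebra Γ(X, U) (Matrix (Fin n) (Fin n) Γ(X, U)))
    (res_mem : ∀ {U V : X.Opens} (h : V ≤ U) {a : Matrix (Fin n) (Fin n) Γ(X, U)},
      a ∈ sections U → matrixRes X n h a ∈ sections V)
    (mem_of_locally_mem : ∀ {U : X.Opens} (a : Matrix (Fin n) (Fin n) Γ(X, U)),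
      (∀ x ∈ U, ∃ (V : X.Opens) (h : V ≤ U), x ∈ V ∧ matrixRes X n h a ∈ sections V) →
      a ∈ sections U)
    (coords : ∀ x, ∃ (U : X.Opens) (e : ℕ) (σ : Fin d ⊕ Fin e ≃ Fin n × Fin n)
      (ξ : Matrix (Fin e) (Fin d) Γ(X, U)), x ∈ U ∧ ∀ (V : X.Opens) (h : V ≤ U)
        (m : Matrix (Fin n) (Fin n) Γ(X, V)),
          m ∈ sections V ↔ defect σ (coordRes X h ξ) m = 0) : Mold n d X where
  sections := sections
  res_mem := res_mem
  mem_of_locally_mem := mem_of_locally_mem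
  locally_free x := by
    obtain ⟨U, e, σ, ξ, hxU, h⟩ := coords x
    refine ⟨U, hxU, frame σ ξ, fun V hV => ?_⟩
    have hf (i : Fin d) : matrixRes X n hV (frame σ ξ i) = frame σ (coordRes X hV ξ) i :=
      map_frame σ _ ξ i
    simp only [hf]
    constructor
    · rw [Fintype.linearIndependent_iff]
      intro g hg i
      have h1 := congrArg (fun m => entry σ m (.inl i)) hg
      rw [entry_sum] at h1
      change ∑ l, g l * entry σ (frame σ (coordRes X hV ξ) l) (.inl i) = 0 at h1
      simpa [entry_frame_inl] using h1
    · ext m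
      rw [Subalgebra.mem_toSubmodule, h V hV]
      constructor
      · intro hm
        have : Submodule.span Γ(X, V) (Set.range fun i => frame σ (coordRes X hV ξ) i) ≤
            LinearMap.ker (defect σ (coordRes X hV ξ)) := by
          rw [Submodule.span_le]
          rintro _ ⟨i, rfl⟩
          exact defect_frame σ _ i
        exact this hm
      · intro hm
        rw [eq_sum_frame σ hm]
        exact Submodule.sum_mem _ fun i _ =>
          Submodule.smul_mem _ _ (Submodule.subset_span ⟨i, rfl⟩)
  quotient_locally_free x := by
    obtain ⟨U, e, σ, ξ, hxU, h⟩ := coords x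
    refine ⟨U, hxU, e, fun c => unitMat σ _ (.inr c), fun V hV => ?_⟩
    have hf (c : Fin e) : matrixRes X n hV (unitMat σ _ (.inr c)) = unitMat σ _ (.inr c) :=
      map_unitMat σ _ _
    simp only [hf]
    constructor
    · rw [Fintype.linearIndependent_iff]
      intro g hg c
      simp only [← map_smul, ← map_sum] at hg
      rw [Submodule.mkQ_apply, Submodule.Quotient.mk_eq_zero, Subalgebra.mem_toSubmodule,
        h V hV] at hg
      have h1 := congrFun hg c
      simpa [map_sum, defect_unitMat_inr, Pi.single_apply] using h1
    · rw [eq_top_iff]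
      intro y _
      obtain ⟨m, rfl⟩ := Submodule.mkQ_surjective _ y
      rw [eq_sum_frame_add σ (coordRes X hV ξ) m, map_add, map_sum, map_sum]
      refine add_mem (Submodule.sum_mem _ fun i _ => ?_) (Submodule.sum_mem _ fun j _ => ?_)
      · have h0 : (Subalgebra.toSubmodule (sections V)).mkQ
            (entry σ m (.inl i) • frame σ (coordRes X hV ξ) i) = 0 := by
          rw [Submodule.mkQ_apply, Submodule.Quotient.mk_eq_zero, Subalgebra.mem_toSubmodule,
            h V hV, map_smul, defect_frame, smul_zero]
        rw [h0]
        exact zero_mem _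
      · rw [map_smul]
        exact Submodule.smul_mem _ _ (Submodule.subset_span ⟨j, rfl⟩)

end AlgebraicGeometry

end

/-! ### Coordinates under pullback and on fibres. -/

noncomputable section

namespace AlgebraicGeometry

open MoldChart

variable {n d e : ℕ} {X Y Z : Scheme.{u}} {σ : Fin d ⊕ Fin e ≃ Fin n × Fin n}

theorem coordRes_appLE (f : Y ⟶ X) {U : X.Opens} {V W : Y.Opens}
    (hV : V ≤ f ⁻¹ᵁ U) (h : W ≤ V) (ξ : Matrix (Fin e) (Fin d) Γ(X, U)) :
    coordRes Y h (ξ.map (f.appLE U V hV).hom) = ξ.map (f.appLE U W (h.trans hV)).hom := by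
  ext i j
  simp only [Matrix.map_apply]
  rw [← CommRingCat.comp_apply, Scheme.Hom.appLE_map]

theorem appLE_coordRes (f : Y ⟶ X) {U U' : X.Opens} {V : Y.Opens}
    (hV : V ≤ f ⁻¹ᵁ U') (h : U' ≤ U) (ξ : Matrix (Fin e) (Fin d) Γ(X, U)) :
    (coordRes X h ξ).map (f.appLE U' V hV).hom =
      ξ.map (f.appLE U V (hV.trans (f.preimage_mono h))).hom := by
  ext i j
  simp only [Matrix.map_apply]
  rw [← CommRingCat.comp_apply, Scheme.Hom.map_appLE]

namespace Mold

/-- The pullback is locally generated by pulled back sections, which lie in the subalgebra of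
solutions; conversely every solution is a combination of the pulled back frame. -/
theorem HasCoords.pullback {A : Mold n d X} {U : X.Opens} {ξ : Matrix (Fin e) (Fin d) Γ(X, U)}
    (h : A.HasCoords σ U ξ) (f : Y ⟶ X) {V : Y.Opens} (hV : V ≤ f ⁻¹ᵁ U) :
    (A.pullback f).HasCoords σ V (ξ.map (f.appLE U V hV).hom) := by
  intro W hW m
  rw [coordRes_appLE]
  constructor
  · intro hm
    refine defect_eq_zero_of_locally fun y hy => ?_
    obtain ⟨U', W', hW', hU', hyW', hmW⟩ := hm y hy
    have hle : W' ≤ f ⁻¹ᵁ (U' ⊓ U) := fun z hz => ⟨hU' hz, hV (hW (hW' hz))⟩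
    refine ⟨W', hW', hyW', ?_⟩
    have h1 := A.matrixExtend_mono f (inf_le_left : U' ⊓ U ≤ U') le_rfl hU' hle hmW
    rw [matrixRes_matrixRes] at h1
    have hc := h.res (inf_le_right : U' ⊓ U ≤ U)
    have h2 := matrixExtend_le (f.appLE (U' ⊓ U) W' hle).hom
      (A := (hc.isMold.map (f.appLE (U' ⊓ U) W' hle).hom).toSubalgebra)
      (fun a ha => defect_map_eq_zero σ _ ((hc.mem_iff a).1 ha)) h1
    rw [IsMold.mem_toSubalgebra, appLE_coordRes] at h2
    rw [coordRes_appLE]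
    exact h2
  · intro hm
    rw [eq_sum_frame σ hm]
    refine sum_mem fun l _ => Subalgebra.smul_mem _ ?_ _
    rw [← map_frame]
    exact A.matrixExtend_le_pullbackSections f (hW.trans hV)
      (mapMatrix_mem_matrixExtend _ ((h.mem_iff _).2 (defect_frame σ ξ l)))

/-- Membership in a mold can be tested after pullback along an open immersion. -/
theorem mem_pullback_iff (A : Mold n d X) (f : Y ⟶ X) [IsOpenImmersion f] {V : X.Opens}
    (hV : V ≤ f.opensRange) {W : Y.Opens} (hW : W = f ⁻¹ᵁ V) (m : Matrix (Fin n) (Fin n) Γ(X, V)) :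
    (f.appLE V W hW.le).hom.mapMatrix m ∈ (A.pullback f).sections W ↔ m ∈ A.sections V := by
  subst hW
  constructor
  · intro hm
    refine A.mem_of_locally_mem m fun x hx => ?_
    obtain ⟨U, e, σ, ξ, hxU, h⟩ := A.exists_hasCoords x
    refine ⟨V ⊓ U, inf_le_left, ⟨hx, hxU⟩, (h _ inf_le_right _).2 ?_⟩
    have hle : f ⁻¹ᵁ (V ⊓ U) ≤ f ⁻¹ᵁ U := f.preimage_mono inf_le_right
    have hc := (h.pullback f hle).mem_iff (matrixRes Y n (f.preimage_mono inf_le_left) _)|>.1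
      ((A.pullback f).res_mem _ hm)
    rw [matrixRes_appLE, ← appLE_matrixRes f le_rfl inf_le_left,
      ← appLE_coordRes f le_rfl inf_le_right] at hc
    refine defect_eq_zero_of_map σ _ ?_ hc
    have hiso : IsIso (f.app (V ⊓ U)) := f.isIso_app _ (inf_le_left.trans hV)
    rw [Scheme.Hom.appLE_eq_app]
    exact (ConcreteCategory.bijective_of_isIso (f.app (V ⊓ U))).1
  · intro hm
    exact A.matrixExtend_le_pullbackSections f le_rfl (mapMatrix_mem_matrixExtend _ hm)

/-- The fibre of a mold in terms of coordinates. -/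
theorem HasCoords.mem_fiber_iff {A : Mold n d X} {U : X.Opens}
    {ξ : Matrix (Fin e) (Fin d) Γ(X, U)} (h : A.HasCoords σ U ξ) (x : X) (hx : x ∈ U)
    (m : Matrix (Fin n) (Fin n) (X.residueField x)) :
    m ∈ A.fiber x ↔ defect σ (ξ.map (X.evaluation U x hx).hom) m = 0 := by
  have hev {V W : X.Opens} (hWV : W ≤ V) (hxW : x ∈ W) :
      X.presheaf.map (homOfLE hWV).op ≫ X.evaluation W x hxW = X.evaluation V x (hWV hxW) := by
    simp [Scheme.evaluation]
  constructor
  · intro hm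
    have hle : A.fiber x ≤ (h.isMold.map (X.evaluation U x hx).hom).toSubalgebra := by
      refine iSup₂_le fun V hxV => matrixExtend_le _ fun a ha => ?_
      rw [IsMold.mem_toSubalgebra]
      have h1 := defect_map_eq_zero σ (X.evaluation (V ⊓ U) x ⟨hxV, hx⟩).hom
        ((h (V ⊓ U) inf_le_right _).1 (A.res_mem inf_le_left ha))
      have e1 : (coordRes X inf_le_right ξ).map (X.evaluation (V ⊓ U) x ⟨hxV, hx⟩).hom =
          ξ.map (X.evaluation U x hx).hom := by
        ext i j
        exact ConcreteCategory.congr_hom (hev (inf_le_right : V ⊓ U ≤ U) ⟨hxV, hx⟩) (ξ i j)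
      have e2 : (X.evaluation (V ⊓ U) x ⟨hxV, hx⟩).hom.mapMatrix (matrixRes X n inf_le_left a) =
          (X.evaluation V x hxV).hom.mapMatrix a := by
        ext i j
        exact ConcreteCategory.congr_hom (hev (inf_le_left : V ⊓ U ≤ V) ⟨hxV, hx⟩) (a i j)
      rwa [e1, e2] at h1
    exact hle hm
  · intro hm
    rw [eq_sum_frame σ hm]
    refine sum_mem fun l _ => Subalgebra.smul_mem _ ?_ _
    rw [← map_frame]
    have hle : matrixExtend (X.evaluation U x hx).hom (A.sections U) ≤ A.fiber x :=
      le_iSup_of_le U (le_iSup_of_le hx le_rfl)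
    exact hle (mapMatrix_mem_matrixExtend _ ((h.mem_iff _).2 (defect_frame σ ξ l)))

/-- The mold with given global coordinates. -/
def ofGlobalCoords {ξ : Matrix (Fin e) (Fin d) Γ(X, ⊤)} (h : IsMold σ ξ) : Mold n d X :=
  Mold.ofCoords (fun U => (h.map (X.presheaf.map (homOfLE (le_top : U ≤ ⊤)).op).hom).toSubalgebra)
    (by
      intro U V hV a ha
      rw [IsMold.mem_toSubalgebra] at ha ⊢
      have := defect_res_eq_zero hV ha
      rwa [coordRes_coordRes] at this)
    (by
      intro U a ha
      rw [IsMold.mem_toSubalgebra]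
      refine defect_eq_zero_of_locally fun x hx => ?_
      obtain ⟨V, hV, hxV, hm⟩ := ha x hx
      refine ⟨V, hV, hxV, ?_⟩
      rw [coordRes_coordRes]
      exact hm)
    (fun x => ⟨⊤, e, σ, ξ, trivial, fun V hV m => Iff.rfl⟩)

theorem hasCoords_ofGlobalCoords {ξ : Matrix (Fin e) (Fin d) Γ(X, ⊤)} (h : IsMold σ ξ) :
    (ofGlobalCoords h).HasCoords σ ⊤ ξ := fun _ _ _ => Iff.rfl

end Mold

end AlgebraicGeometry

end

/-! ### Zariski descent for molds. -/

noncomputable section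

namespace AlgebraicGeometry

open MoldChart

variable {n d : ℕ} {X Y : Scheme.{u}}

namespace Mold

theorem ext_of_openCover (𝓤 : Y.OpenCover) {A B : Mold n d Y}
    (h : ∀ j, A.pullback (𝓤.f j) = B.pullback (𝓤.f j)) : A = B := by
  ext V m
  constructor
  all_goals
    intro hm
    refine Mold.mem_of_locally_mem _ m fun y hy => ?_
    obtain ⟨j, z, rfl⟩ := 𝓤.exists_eq y
    refine ⟨V ⊓ (𝓤.f j).opensRange, inf_le_left, ⟨hy, z, rfl⟩, ?_⟩
    rw [← mem_pullback_iff _ (𝓤.f j) inf_le_right rfl]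
  · rw [← h, mem_pullback_iff _ (𝓤.f j) inf_le_right rfl]
    exact A.res_mem _ hm
  · rw [h, mem_pullback_iff _ (𝓤.f j) inf_le_right rfl]
    exact B.res_mem _ hm

/-- The sections over `V` of the mold glued from molds on an open cover. -/
def glueSections (𝓤 : Y.OpenCover) (A : ∀ j, Mold n d (𝓤.X j)) (V : Y.Opens) :
    Subalgebra Γ(Y, V) (Matrix (Fin n) (Fin n) Γ(Y, V)) where
  carrier := {m | ∀ j, ((𝓤.f j).appLE V (𝓤.f j ⁻¹ᵁ V) le_rfl).hom.mapMatrix m ∈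
    (A j).sections (𝓤.f j ⁻¹ᵁ V)}
  mul_mem' ha hb j := by
    rw [map_mul]
    exact mul_mem (ha j) (hb j)
  add_mem' ha hb j := by
    rw [map_add]
    exact add_mem (ha j) (hb j)
  algebraMap_mem' r j := by
    rw [Algebra.algebraMap_eq_smul_one, mapMatrix_smul', map_one]
    exact Subalgebra.smul_mem _ (one_mem _) _

/-- Inside the range of the `j`-th member, one member of the cover suffices: the preimage of `V` in
the `i`-th member is covered by the fibre product of the two, where the molds agree. -/
theorem mem_glueSections_of_mem (𝓤 : Y.OpenCover) (A : ∀ j, Mold n d (𝓤.X j))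
    (hA : ∀ (i j : 𝓤.I₀) (Z : Scheme.{u}) (g : Z ⟶ 𝓤.X i) (g' : Z ⟶ 𝓤.X j),
      g ≫ 𝓤.f i = g' ≫ 𝓤.f j → (A i).pullback g = (A j).pullback g')
    (j : 𝓤.I₀) {V : Y.Opens} (hV : V ≤ (𝓤.f j).opensRange) {m : Matrix (Fin n) (Fin n) Γ(Y, V)}
    (hm : ((𝓤.f j).appLE V (𝓤.f j ⁻¹ᵁ V) le_rfl).hom.mapMatrix m ∈
      (A j).sections (𝓤.f j ⁻¹ᵁ V)) : m ∈ glueSections 𝓤 A V := by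
  intro i
  let g := Limits.pullback.fst (𝓤.f i) (𝓤.f j)
  let g' := Limits.pullback.snd (𝓤.f i) (𝓤.f j)
  have hg : g ≫ 𝓤.f i = g' ≫ 𝓤.f j := Limits.pullback.condition
  have hr : 𝓤.f i ⁻¹ᵁ V ≤ g.opensRange := by
    intro z hz
    rw [← SetLike.mem_coe, Scheme.Hom.coe_opensRange, IsOpenImmersion.range_pullbackFst]
    exact hV hz
  have hle : g ⁻¹ᵁ (𝓤.f i ⁻¹ᵁ V) ≤ g' ⁻¹ᵁ (𝓤.f j ⁻¹ᵁ V) := by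
    change (g ≫ 𝓤.f i) ⁻¹ᵁ V ≤ (g' ≫ 𝓤.f j) ⁻¹ᵁ V
    rw [hg]
  rw [← mem_pullback_iff _ g hr rfl, hA i j _ g g' hg]
  have h1 := (A j).matrixExtend_le_pullbackSections g' hle (mapMatrix_mem_matrixExtend _ hm)
  rw [appLE_appLE_mapMatrix] at h1 ⊢
  have h2 : (g ≫ 𝓤.f i).appLE V (g ⁻¹ᵁ (𝓤.f i ⁻¹ᵁ V)) le_rfl =
      (g' ≫ 𝓤.f j).appLE V (g ⁻¹ᵁ (𝓤.f i ⁻¹ᵁ V)) hle := by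
    congr 1
  exact (congrArg (fun φ => φ.hom.mapMatrix m ∈ ((A j).pullback g').sections _) h2).mpr h1

/-- Molds on an open cover which agree on overlaps can be glued. -/
theorem exists_glue (𝓤 : Y.OpenCover) (A : ∀ j, Mold n d (𝓤.X j))
    (hA : ∀ (i j : 𝓤.I₀) (Z : Scheme.{u}) (g : Z ⟶ 𝓤.X i) (g' : Z ⟶ 𝓤.X j),
      g ≫ 𝓤.f i = g' ≫ 𝓤.f j → (A i).pullback g = (A j).pullback g') :
    ∃ B : Mold n d Y, ∀ j, B.pullback (𝓤.f j) = A j := by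
  -- Coordinates of the `j`-th mold are carried to an open subset of `Y` through the isomorphism on
  -- sections, and there they describe the glued sections. This gives both that the glued object is
  -- a mold and that it restricts to the given ones.
  have key (j : 𝓤.I₀) (z : 𝓤.X j) : ∃ (U : Y.Opens) (e : ℕ) (σ : Fin d ⊕ Fin e ≃ Fin n × Fin n)
      (ξ : Matrix (Fin e) (Fin d) Γ(Y, U)), 𝓤.f j z ∈ U ∧
      (A j).HasCoords σ (𝓤.f j ⁻¹ᵁ U) (ξ.map ((𝓤.f j).appLE U _ le_rfl).hom) ∧
      ∀ (V : Y.Opens) (h : V ≤ U) (m : Matrix (Fin n) (Fin n) Γ(Y, V)),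
          m ∈ glueSections 𝓤 A V ↔ defect σ (coordRes Y h ξ) m = 0 := by
    obtain ⟨U, e, σ, η, hzU, h⟩ := (A j).exists_hasCoords z
    have hU : 𝓤.f j ''ᵁ U ≤ (𝓤.f j).opensRange := (𝓤.f j).image_le_opensRange U
    have hle : 𝓤.f j ⁻¹ᵁ (𝓤.f j ''ᵁ U) ≤ U := ((𝓤.f j).preimage_image_eq U).le
    have hbij {V : Y.Opens} (hV : V ≤ (𝓤.f j).opensRange) :
        Function.Bijective ((𝓤.f j).appLE V (𝓤.f j ⁻¹ᵁ V) le_rfl).hom := by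
      have hiso : IsIso ((𝓤.f j).app V) := (𝓤.f j).isIso_app _ hV
      rw [Scheme.Hom.appLE_eq_app]
      exact ConcreteCategory.bijective_of_isIso ((𝓤.f j).app V)
    choose s hs using (hbij hU).2
    let ξ : Matrix (Fin e) (Fin d) Γ(Y, 𝓤.f j ''ᵁ U) := (coordRes _ hle η).map s
    have hξ : ξ.map ((𝓤.f j).appLE (𝓤.f j ''ᵁ U) _ le_rfl).hom = coordRes _ hle η := by
      ext c l
      exact hs _
    have hc := h.res hle
    rw [← hξ] at hc
    refine ⟨𝓤.f j ''ᵁ U, e, σ, ξ, ⟨z, hzU, rfl⟩, hc, fun V hV m => ?_⟩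
    have hVj := hc (𝓤.f j ⁻¹ᵁ V) ((𝓤.f j).preimage_mono hV)
      (((𝓤.f j).appLE V (𝓤.f j ⁻¹ᵁ V) le_rfl).hom.mapMatrix m)
    rw [coordRes_appLE, ← appLE_coordRes (𝓤.f j) le_rfl hV] at hVj
    constructor
    · intro hm
      exact defect_eq_zero_of_map σ _ (hbij (hV.trans hU)).1 (hVj.1 (hm j))
    · intro hm
      exact mem_glueSections_of_mem 𝓤 A hA j (hV.trans hU) (hVj.2 (defect_map_eq_zero σ _ hm))
  let B : Mold n d Y := Mold.ofCoords (glueSections 𝓤 A)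
    (by
      intro U V hV a ha j
      have h1 := (A j).res_mem ((𝓤.f j).preimage_mono hV) (ha j)
      rw [matrixRes_appLE] at h1
      rwa [appLE_matrixRes])
    (by
      intro U a ha j
      refine (A j).mem_of_locally_mem _ fun z hz => ?_
      obtain ⟨V, hV, hzV, hm⟩ := ha (𝓤.f j z) hz
      refine ⟨𝓤.f j ⁻¹ᵁ V, (𝓤.f j).preimage_mono hV, hzV, ?_⟩
      have h1 := hm j
      rw [appLE_matrixRes] at h1
      rwa [matrixRes_appLE])
    (fun y => by
      obtain ⟨j, z, rfl⟩ := 𝓤.exists_eq y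
      obtain ⟨U, e, σ, ξ, hz, -, h⟩ := key j z
      exact ⟨U, e, σ, ξ, hz, h⟩)
  refine ⟨B, fun j => ext_of_hasCoords fun z => ?_⟩
  obtain ⟨U, e, σ, ξ, hz, hc, h⟩ := key j z
  exact ⟨_, e, σ, _, hz, HasCoords.pullback (A := B) h (𝓤.f j) le_rfl, hc⟩

end Mold

theorem isSheaf_moldFunctor (n d : ℕ) :
    Presieve.IsSheaf Scheme.zariskiTopology.{u} (moldFunctor.{u} n d) := by
  rw [Precoverage.isSheaf_toGrothendieck_iff_of_isStableUnderBaseChange]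
  rintro Y S hS x hx
  obtain ⟨(𝓤 : Scheme.OpenCover Y), rfl⟩ := Scheme.exists_cover_of_mem_pretopology hS
  obtain ⟨B, hB⟩ := Mold.exists_glue 𝓤 (fun j => x (𝓤.f j) (.mk j))
    (fun i j Z g g' h => hx g g' (.mk i) (.mk j) h)
  refine ⟨B, ?_, fun B' hB' => Mold.ext_of_openCover 𝓤 fun j => ?_⟩
  · rintro Z f ⟨j⟩
    exact hB j
  · exact (hB' (𝓤.f j) (.mk j)).trans (hB j).symm

end AlgebraicGeometry

end

noncomputable section

namespace AlgebraicGeometry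

open MoldChart

variable {n d e : ℕ} {X Y : Scheme.{u}} (σ : Fin d ⊕ Fin e ≃ Fin n × Fin n)

/-! ### The charts of the functor of molds -/

/-- The affine scheme of molds with coordinates in the chart attached to `σ`. -/
abbrev chartScheme : Scheme.{u} := Spec (.of (ChartRing σ (ULift.{u} ℤ)))

/-- The comorphism on global sections of a morphism to a chart. -/
def chartHom (g : Y ⟶ chartScheme.{u} σ) : ChartRing σ (ULift.{u} ℤ) →+* Γ(Y, ⊤) :=
  ((Scheme.ΓSpecIso (.of (ChartRing σ (ULift.{u} ℤ)))).inv ≫ g.appTop).hom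

theorem chartHom_injective {g g' : Y ⟶ chartScheme.{u} σ} (h : chartHom σ g = chartHom σ g') :
    g = g' :=
  ext_to_Spec (CommRingCat.hom_ext h)

theorem exists_chartHom_eq (f : ChartRing σ (ULift.{u} ℤ) →+* Γ(Y, ⊤)) :
    ∃ g : Y ⟶ chartScheme.{u} σ, chartHom σ g = f := by
  refine ⟨Y.toSpecΓ ≫ Spec.map (CommRingCat.ofHom f), ?_⟩
  have h : (Scheme.ΓSpecIso (.of (ChartRing σ (ULift.{u} ℤ)))).inv ≫
      (Y.toSpecΓ ≫ Spec.map (CommRingCat.ofHom f)).appTop = CommRingCat.ofHom f := by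
    rw [Scheme.Hom.comp_appTop, Scheme.toSpecΓ_appTop, Scheme.ΓSpecIso_naturality,
      Iso.inv_hom_id_assoc]
  exact congrArg CommRingCat.Hom.hom h

/-- The universal mold on a chart. -/
def chartMold : Mold n d (chartScheme.{u} σ) :=
  Mold.ofGlobalCoords ((isMold_chartCoord σ (ULift.{u} ℤ)).map (chartHom σ (𝟙 _)))

theorem hasCoords_chartMold_pullback (g : Y ⟶ chartScheme.{u} σ) :
    ((chartMold σ).pullback g).HasCoords σ ⊤ ((chartCoord σ (ULift.{u} ℤ)).map (chartHom σ g)) := by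
  have h := (Mold.hasCoords_ofGlobalCoords
    ((isMold_chartCoord σ (ULift.{u} ℤ)).map (chartHom σ (𝟙 _)))).pullback g (V := ⊤) le_rfl
  have hg : (g.appLE ⊤ ⊤ le_rfl).hom.comp (chartHom σ (𝟙 _)) = chartHom σ g := by
    have : g.appLE ⊤ ⊤ le_rfl = g.appTop := Scheme.Hom.appLE_eq_app g
    rw [this, chartHom, chartHom, Scheme.Hom.id_appTop, Category.comp_id]
    rfl
  have hξ : ((chartCoord σ (ULift.{u} ℤ)).map (chartHom σ (𝟙 _))).map (g.appLE ⊤ ⊤ le_rfl).hom =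
      (chartCoord σ (ULift.{u} ℤ)).map (chartHom σ g) := by
    rw [← hg]
    rfl
  rw [← hξ]
  exact h

/-- Uniqueness of coordinates. Together with `exists_chartMold_pullback_eq`, it says that the chart
represents molds with global coordinates for `σ`. -/
theorem chartMold_pullback_injective {g g' : Y ⟶ chartScheme.{u} σ}
    (h : (chartMold σ).pullback g = (chartMold σ).pullback g') : g = g' := by
  apply chartHom_injective
  apply chartRing_hom_ext
  have h' := hasCoords_chartMold_pullback σ g'
  rw [← h] at h'
  exact (hasCoords_chartMold_pullback σ g).unique h'

theorem exists_chartMold_pullback_eq {A : Mold n d Y} {ξ : Matrix (Fin e) (Fin d) Γ(Y, ⊤)}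
    (h : A.HasCoords σ ⊤ ξ) : ∃ g : Y ⟶ chartScheme.{u} σ, (chartMold σ).pullback g = A := by
  obtain ⟨f, rfl⟩ := exists_chartRing_hom.{u} σ h.isMold
  obtain ⟨g, rfl⟩ := exists_chartHom_eq σ f
  exact ⟨g, Mold.ext_of_hasCoords fun x =>
    ⟨⊤, e, σ, _, trivial, hasCoords_chartMold_pullback σ g, h⟩⟩

/-- The open subset on which a mold has coordinates in the chart attached to `σ`. -/
def Mold.chartLocus (A : Mold n d X) : X.Opens :=
  ⨆ W : {W : X.Opens // ∃ ξ, A.HasCoords σ W ξ}, W.1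

theorem Mold.HasCoords.le_chartLocus {A : Mold n d X} {σ : Fin d ⊕ Fin e ≃ Fin n × Fin n}
    {U : X.Opens} {ξ : Matrix (Fin e) (Fin d) Γ(X, U)} (h : A.HasCoords σ U ξ) :
    U ≤ A.chartLocus σ :=
  le_iSup (fun W : {W : X.Opens // ∃ ξ, A.HasCoords σ W ξ} => W.1) ⟨U, ξ, h⟩

/-- Coordinates are unique, so local ones agree on overlaps and their entries glue. -/
theorem Mold.exists_hasCoords_chartLocus (A : Mold n d X) :
    ∃ ξ, A.HasCoords σ (A.chartLocus σ) ξ := by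
  let ι := {W : X.Opens // ∃ ξ, A.HasCoords σ W ξ}
  let U : ι → X.Opens := Subtype.val
  choose η hη using fun W : ι => W.2
  have hcompat (W W' : ι) : coordRes X (inf_le_left : W.1 ⊓ W'.1 ≤ W.1) (η W) =
      coordRes X (inf_le_right : W.1 ⊓ W'.1 ≤ W'.1) (η W') :=
    ((hη W).res inf_le_left).unique ((hη W').res inf_le_right)
  have hglue (c : Fin e) (l : Fin d) : ∃ s : Γ(X, A.chartLocus σ), ∀ W : ι,
      (X.presheaf.map (homOfLE (hη W).le_chartLocus).op).hom s = η W c l := by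
    obtain ⟨s, hs, -⟩ := X.sheaf.existsUnique_gluing' U (A.chartLocus σ)
      (fun W => homOfLE (hη W).le_chartLocus) le_rfl (fun W => η W c l)
      (fun W W' => congrFun (congrFun (hcompat W W') c) l)
    exact ⟨s, hs⟩
  choose ξ hξ using hglue
  refine ⟨Matrix.of ξ, Mold.hasCoords_of_locally fun x hx => ?_⟩
  rw [Mold.chartLocus, TopologicalSpace.Opens.mem_iSup] at hx
  obtain ⟨W, hxW⟩ := hx
  refine ⟨W.1, (hη W).le_chartLocus, hxW, ?_⟩
  convert hη W
  ext c l
  exact hξ c l W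

/-- A morphism along which the pullback of a mold has global coordinates factors through the
locus where the mold has coordinates. -/
theorem Mold.HasCoords.mem_chartLocus {A : Mold n d X} (f : Y ⟶ X)
    {σ : Fin d ⊕ Fin e ≃ Fin n × Fin n} {ζ : Matrix (Fin e) (Fin d) Γ(Y, ⊤)}
    (h : (A.pullback f).HasCoords σ ⊤ ζ) (y : Y) : f y ∈ A.chartLocus σ := by
  obtain ⟨U, hyU, e', t, ht⟩ := A.exists_basis (f y)
  obtain ⟨t', ht', hspan⟩ := A.exists_basis_pullback f t ht (f ⁻¹ᵁ U) le_rfl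
  obtain ⟨ξ, hξ⟩ := A.exists_hasCoords_basicOpen σ (fun i => t (Sum.inl i)) ht
  refine hξ.le_chartLocus ?_
  set q : Matrix (Fin d) (Fin d) Γ(X, U) :=
    Matrix.of fun i l => entry σ (t (Sum.inl i)) (.inl l) with hq
  let φ := (f.appLE U (f ⁻¹ᵁ U) le_rfl).hom
  have hc := h.res (le_top : f ⁻¹ᵁ U ≤ ⊤)
  have hmem (l : Fin d) : frame σ (coordRes Y le_top ζ) l ∈
      Submodule.span Γ(Y, f ⁻¹ᵁ U) (Set.range fun i => t' (Sum.inl i)) := by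
    rw [hspan]
    exact (hc.mem_iff _).2 (defect_frame σ _ l)
  choose a ha using fun l => (Submodule.mem_span_range_iff_exists_fun _).1 (hmem l)
  -- The frame has identity free entries, so its expansion in the pulled back basis inverts the
  -- pulled back minor. The determinant is thus a unit on `f ⁻¹ᵁ U`, which forces `f y` into the
  -- basic open of the minor.
  have hone : Matrix.of a * φ.mapMatrix q = 1 := by
    ext l k
    have h1 := congrArg (fun m => entry σ m (.inl k)) (ha l)
    simp only [entry_frame_inl] at h1
    rw [entry_sum] at h1
    rw [Matrix.one_apply, ← h1, Matrix.mul_apply]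
    refine Finset.sum_congr rfl fun i _ => ?_
    rw [ht']
    rfl
  have hunit : IsUnit (φ q.det) := by
    rw [RingHom.map_det]
    exact Matrix.isUnit_det_of_left_inverse hone
  have hy : y ∈ Y.basicOpen (φ q.det) := by
    rw [Scheme.basicOpen_of_isUnit _ hunit]
    exact hyU
  have hpre : f ⁻¹ᵁ X.basicOpen q.det = Y.basicOpen (φ q.det) := by
    simp only [φ]
    rw [Scheme.Hom.appLE_eq_app]
    exact Scheme.preimage_basicOpen f q.det
  rw [← hpre] at hy
  exact hy

/-- The inclusion of a chart into the functor of molds. -/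
def chartMap : yoneda.obj (chartScheme.{u} σ) ⟶ moldFunctor.{u} n d :=
  yonedaEquiv.symm (chartMold σ)

/-- The fibre of the chart over a mold on `X` is the open locus where the mold has coordinates: a
test morphism to `X` along which coordinates exist lands in that locus by
`Mold.HasCoords.mem_chartLocus`. This makes the chart an open subfunctor. -/
theorem isPullback_chartMap (A : Mold n d X) :
    ∃ g : (A.chartLocus σ).toScheme ⟶ chartScheme.{u} σ,
      IsPullback (yoneda.map g) (yoneda.map (A.chartLocus σ).ι) (chartMap σ)
        (yonedaEquiv.symm (A : (moldFunctor.{u} n d).obj (op X))) := by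
  obtain ⟨ξ, hξ⟩ := A.exists_hasCoords_chartLocus σ
  obtain ⟨g, hg⟩ := exists_chartMold_pullback_eq σ
    (hξ.pullback (A.chartLocus σ).ι (V := ⊤) (by simp))
  refine ⟨g, IsPullback.of_forall_isPullback_app fun Z => ?_⟩
  rw [Limits.Types.isPullback_iff]
  refine ⟨?_, ?_, ?_⟩
  · ext c
    change (chartMold σ).pullback (c ≫ g) = A.pullback (c ≫ (A.chartLocus σ).ι)
    rw [Mold.pullback_comp, Mold.pullback_comp, hg]
  · rintro c c' ⟨-, h⟩
    exact (cancel_mono (A.chartLocus σ).ι).1 h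
  · intro (a : Z.unop ⟶ chartScheme.{u} σ) (b : Z.unop ⟶ X) hab
    change (chartMold σ).pullback a = A.pullback b at hab
    have hc := hasCoords_chartMold_pullback σ a
    rw [hab] at hc
    have hr : Set.range b ⊆ Set.range (A.chartLocus σ).ι := by
      rintro _ ⟨z, rfl⟩
      rw [Scheme.Opens.range_ι]
      exact hc.mem_chartLocus b z
    refine ⟨IsOpenImmersion.lift (A.chartLocus σ).ι b hr, ?_, IsOpenImmersion.lift_fac _ _ _⟩
    apply chartMold_pullback_injective σ
    change (chartMold σ).pullback (IsOpenImmersion.lift (A.chartLocus σ).ι b hr ≫ g) = _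
    rw [Mold.pullback_comp, hg, ← Mold.pullback_comp, IsOpenImmersion.lift_fac, hab]

theorem isOpenImmersion_chartMap : IsOpenImmersion.presheaf (chartMap.{u} σ) := by
  refine MorphismProperty.relative.of_exists fun X A => ?_
  obtain ⟨A, rfl⟩ := yonedaEquiv.symm.surjective A
  obtain ⟨g, hg⟩ := isPullback_chartMap σ (A : Mold n d X)
  exact ⟨_, yoneda.map g, _, hg, inferInstance⟩

/-- The labels of the charts. -/
abbrev ChartIndex (n d : ℕ) : Type u :=
  ULift.{u} (Σ e : ℕ, Fin d ⊕ Fin e ≃ Fin n × Fin n)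

theorem isLocallySurjective_sigmaDesc {ι : Type u} {P : ι → Scheme.{u}ᵒᵖ ⥤ Type u}
    {F : Scheme.{u}ᵒᵖ ⥤ Type u} (f : ∀ i, P i ⟶ F)
    (h : ∀ (X : Scheme.{u}) (s : F.obj (op X)), ∃ 𝓤 : X.OpenCover, ∀ j, ∃ (i : ι)
      (t : (P i).obj (op (𝓤.X j))), (f i).app _ t = F.map (𝓤.f j).op s) :
    Presheaf.IsLocallySurjective Scheme.zariskiTopology.{u} (Limits.Sigma.desc f) where
  imageSieve_mem {X} s := by
    obtain ⟨𝓤, h𝓤⟩ := h X s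
    refine GrothendieckTopology.superset_covering _ ?_ 𝓤.mem_grothendieckTopology
    rw [Sieve.generate_le_iff]
    rintro _ _ ⟨j⟩
    obtain ⟨i, t, ht⟩ := h𝓤 j
    refine ⟨(Limits.Sigma.ι P i).app _ t, ?_⟩
    exact (ConcreteCategory.congr_hom
      (NatTrans.congr_app (Limits.Sigma.ι_desc f i) (op (𝓤.X j))) t).trans ht

theorem isLocallySurjective_chartMap (n d : ℕ) :
    Presheaf.IsLocallySurjective Scheme.zariskiTopology.{u}
      (Limits.Sigma.desc fun i : ChartIndex.{u} n d => chartMap.{u} i.down.2) := by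
  refine isLocallySurjective_sigmaDesc _ fun X (A : Mold n d X) => ?_
  choose U e σ ξ hxU hξ using A.exists_hasCoords
  refine ⟨X.openCoverOfIsOpenCover U ?_, fun x => ?_⟩
  · rw [TopologicalSpace.IsOpenCover, eq_top_iff]
    exact fun x _ => TopologicalSpace.Opens.mem_iSup.2 ⟨x, hxU x⟩
  · obtain ⟨g, hg⟩ := exists_chartMold_pullback_eq (σ x)
      ((hξ x).pullback (U x).ι (V := ⊤) (by simp))
    exact ⟨⟨⟨e x, σ x⟩⟩, g, hg⟩

/-- A Zariski sheaf covered by representable open subfunctors is representable. -/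
theorem isRepresentable_moldFunctor (n d : ℕ) : (moldFunctor.{u} n d).IsRepresentable := by
  have := isLocallySurjective_chartMap.{u} n d
  exact Scheme.LocalRepresentability.isRepresentable
    (F := ⟨moldFunctor.{u} n d, (isSheaf_iff_isSheaf_of_type _ _).2 (isSheaf_moldFunctor n d)⟩)
    (f := fun i : ChartIndex.{u} n d => chartMap.{u} i.down.2)
    (fun i => isOpenImmersion_chartMap i.down.2)

end AlgebraicGeometry

end

noncomputable section

namespace AlgebraicGeometry

open MoldChart

variable {n d e : ℕ} {M : Scheme.{u}} (σ : Fin d ⊕ Fin e ≃ Fin n × Fin n)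

/-! ### Smoothness of the scheme of molds -/

theorem homEquiv_eq_pullback (h : (moldFunctor.{u} n d).RepresentableBy M) {Y : Scheme.{u}}
    (f : Y ⟶ M) : h.homEquiv f = (universalMold h).pullback f :=
  h.homEquiv_eq f

/-- On a scheme representing the functor of molds, the locus where the universal mold has
coordinates in a given chart is isomorphic to that chart. -/
theorem isIso_of_chartMold_pullback_eq (h : (moldFunctor.{u} n d).RepresentableBy M)
    {U : M.Opens} (hU : U = (universalMold h).chartLocus σ) (g : U.toScheme ⟶ chartScheme.{u} σ)
    (hg : (chartMold σ).pullback g = (universalMold h).pullback U.ι) : IsIso g := by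
  -- The morphism classifying the chart mold lands in `U`, and its lift to `U` is the inverse of
  -- `g`.
  let j : chartScheme.{u} σ ⟶ M := h.homEquiv.symm (chartMold σ)
  have hj : (universalMold h).pullback j = chartMold σ :=
    (homEquiv_eq_pullback h j).symm.trans (h.homEquiv.apply_symm_apply (chartMold σ))
  have hgj : g ≫ j = U.ι := by
    apply h.homEquiv.injective
    refine (homEquiv_eq_pullback h _).trans (.trans ?_ (homEquiv_eq_pullback h _).symm)
    rw [Mold.pullback_comp, hj, hg]
  have hr : Set.range j ⊆ Set.range U.ι := by
    rintro _ ⟨z, rfl⟩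
    rw [Scheme.Opens.range_ι]
    have hc := hasCoords_chartMold_pullback σ (𝟙 (chartScheme.{u} σ))
    rw [← hj, ← Mold.pullback_comp, Category.id_comp] at hc
    exact hU ▸ hc.mem_chartLocus j z
  refine ⟨IsOpenImmersion.lift U.ι j hr, ?_, ?_⟩
  · rw [← cancel_mono U.ι, Category.assoc, IsOpenImmersion.lift_fac, hgj, Category.id_comp]
  · apply chartMold_pullback_injective σ
    rw [Mold.pullback_comp, hg, ← Mold.pullback_comp, IsOpenImmersion.lift_fac, hj]
    exact (Mold.pullback_id _).symm

/-- If `Spec R` is terminal, `Spec B` is an open subscheme of `X` and `B` becomes smooth over `R`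
after inverting `r`, then `X` is smooth over `Spec R` at the points of `Spec B` where `r` does not
vanish. -/
theorem isSmoothAt_of_localizationAway {X : Scheme.{u}} {R B : Type u} [CommRing R]
    [CommRing B] [Algebra R B] (hS : Limits.IsTerminal (Spec (.of R))) (j : Spec (.of B) ⟶ X) [IsOpenImmersion j] (r : B) [Algebra.Smooth R (Localization.Away r)]
    (y : Spec (.of B)) (hy : y ∈ (Spec (.of B)).basicOpen ((Scheme.ΓSpecIso (.of B)).inv r)) :
    IsSmoothAt (hS.from X) (j y) := by
  have hyr : y ∈ (PrimeSpectrum.basicOpen r : Set (PrimeSpectrum B)) := by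
    have := basicOpen_eq_of_affine (R := .of B) r
    exact (congrArg (fun V : (Spec (.of B)).Opens => y ∈ V) this).mp hy
  let φ : CommRingCat.of B ⟶ .of (Localization.Away r) :=
    CommRingCat.ofHom (algebraMap B (Localization.Away r))
  have hφ : IsOpenImmersion (Spec.map φ) :=
    inferInstanceAs (IsOpenImmersion
      (Spec.map (CommRingCat.ofHom (algebraMap B (Localization.Away r)))))
  let i : Spec (.of (Localization.Away r)) ⟶ X := Spec.map φ ≫ j
  refine ⟨i.opensRange, ?_, ?_⟩
  · have : y ∈ Set.range (Spec.map φ) :=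
      (PrimeSpectrum.localization_away_comap_range (Localization.Away r) r).symm ▸ hyr
    obtain ⟨z, rfl⟩ := this
    exact ⟨z, by simp [i]⟩
  · have hsm : Smooth (Spec.map (CommRingCat.ofHom (algebraMap R (Localization.Away r)))) := by
      rw [HasRingHomProperty.Spec_iff (P := @Smooth)]
      exact RingHom.smooth_algebraMap.2 inferInstance
    -- The two structure morphisms agree because their target is terminal, so no compatibility of
    -- `j` with the base has to be assumed.
    have : i.opensRange.ι ≫ hS.from X = i.isoOpensRange.inv ≫
        Spec.map (CommRingCat.ofHom (algebraMap R (Localization.Away r))) :=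
      hS.hom_ext _ _
    rw [this]
    infer_instance

theorem isSmoothAt_of_subsingleton_hochschildCohomology
    (h : (moldFunctor.{u} n d).RepresentableBy M) (x : M)
    (hH : Subsingleton (HochschildCohomology (M.residueField x) ((universalMold h).fiber x)
        (Matrix (Fin n) (Fin n) (M.residueField x) ⧸
          Subalgebra.toSubmodule ((universalMold h).fiber x)) 2)) :
    IsSmoothAt (specULiftZIsTerminal.{u}.from M) x := by
  obtain ⟨U₀, e, σ, ξ₀, hxU₀, hξ₀⟩ := (universalMold h).exists_hasCoords x
  obtain ⟨U, hU⟩ : ∃ U, U = (universalMold h).chartLocus σ := ⟨_, rfl⟩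
  have hxU : x ∈ U := hU ▸ hξ₀.le_chartLocus hxU₀
  obtain ⟨ξ, hξ⟩ : ∃ ξ, (universalMold h).HasCoords σ U ξ :=
    hU ▸ (universalMold h).exists_hasCoords_chartLocus σ
  obtain ⟨ψ, hψ⟩ := exists_chartRing_hom.{u} σ hξ.isMold
  obtain ⟨z, hz⟩ : ∃ z : U.toScheme, U.ι z = x := ⟨⟨x, hxU⟩, rfl⟩
  have hle : (⊤ : U.toScheme.Opens) ≤ U.ι ⁻¹ᵁ U := by simp
  obtain ⟨g, hg⟩ := exists_chartHom_eq σ ((U.ι.appLE U ⊤ hle).hom.comp ψ)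
  have hgU : (chartMold σ).pullback g = (universalMold h).pullback U.ι := by
    have hc := hasCoords_chartMold_pullback σ g
    have hm : (chartCoord σ (ULift.{u} ℤ)).map (chartHom σ g) =
        ξ.map (U.ι.appLE U ⊤ hle).hom := by
      rw [hg, ← hψ]
      rfl
    rw [hm] at hc
    exact Mold.ext_of_hasCoords fun x => ⟨⊤, e, σ, _, trivial, hc, hξ.pullback U.ι hle⟩
  have := isIso_of_chartMold_pullback_eq σ h hU g hgU
  -- The kernel of `f` is the prime of the chart corresponding to `x`, and `f` sends the universal
  -- coordinates to those of the fibre at `x`.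
  let f : ChartRing σ (ULift.{u} ℤ) →+* M.residueField x := (M.evaluation U x hxU).hom.comp ψ
  have hprime : (RingHom.ker f).IsPrime := RingHom.ker_isPrime f
  have hsm : Algebra.IsSmoothAt (ULift.{u} ℤ) (RingHom.ker f) := by
    refine isSmoothAt_chartRing σ f ((universalMold h).fiber x) (fun m => ?_) hH
    rw [hξ.mem_fiber_iff x hxU, ← hψ]
    rfl
  -- By finite presentation, smoothness at a prime spreads to a basic open neighbourhood; `r` does
  -- not vanish at `x` since `f r ≠ 0`.
  obtain ⟨r, hr, hsmr⟩ := Algebra.IsSmoothAt.exists_notMem_smooth (ULift.{u} ℤ) (RingHom.ker f)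
  have hx : x ∈ M.basicOpen (ψ r) :=
    (Scheme.evaluation_ne_zero_iff_mem_basicOpen M x hxU (ψ r)).1 hr
  have hy : z ∈ g ⁻¹ᵁ (chartScheme.{u} σ).basicOpen
      ((Scheme.ΓSpecIso (.of (ChartRing σ (ULift.{u} ℤ)))).inv r) := by
    have hgr : g.appTop ((Scheme.ΓSpecIso (.of (ChartRing σ (ULift.{u} ℤ)))).inv r) =
        U.ι.appLE U ⊤ hle (ψ r) :=
      congrArg (fun k => k r) hg
    rw [Scheme.preimage_basicOpen_top, hgr, Scheme.basicOpen_appLE]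
    exact ⟨trivial, show U.ι z ∈ _ from hz ▸ hx⟩
  -- `inv g ≫ U.ι` embeds the chart as an open subscheme of `M` and sends `g z` to `x`.
  have hsmooth := isSmoothAt_of_localizationAway specULiftZIsTerminal.{u} (inv g ≫ U.ι) r
    (g z) hy
  rwa [← Scheme.Hom.comp_apply, IsIso.hom_inv_id_assoc, hz] at hsmooth

end AlgebraicGeometry

end

theorem theorem1p2 (n d : ℕ) :
    (moldFunctor.{u} n d).IsRepresentable ∧
    ∀ (M : Scheme.{u}) (h : (moldFunctor.{u} n d).RepresentableBy M) (x : M),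
      Subsingleton (HochschildCohomology (M.residueField x) ((universalMold h).fiber x)
        (Matrix (Fin n) (Fin n) (M.residueField x) ⧸
          Subalgebra.toSubmodule ((universalMold h).fiber x)) 2) →
      IsSmoothAt (specULiftZIsTerminal.{u}.from M) x :=
  ⟨isRepresentable_moldFunctor n d, fun _ h x hH =>
    isSmoothAt_of_subsingleton_hochschildCohomology h x hH⟩
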